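/- Consider the word RAM model: memory cells and registers hold words of $O(\log n)$ bits (natural numbers less than $(n+2)^k$ for a constant $k$), and each arithmetic operation (addition, truncated subtraction, multiplication, comparison), memory access (with computed address) and test takes one unit of time. There is a deterministic algorithm (a fixed program, with fixed constants $C$ and $k$) such that the following holds for every finite simple graph $G$ with $n$ vertices $0,\dots,n-1$ and maximum degree $\Delta$. Given $n$, the number $m$ of edges, and a list of the edges of $G$ in which each edge occurs exactly once (in arbitrary order and with its two ends in arbitrary order), the algorithm halts after at most $C\,(n^2\Delta+1)$ units of time, that is, in time $O(n^2\Delta)$ if $G$ has an edge and in time $O(1)$ otherwise, and outputs for each edge of the list its colour in a proper edge colouring of $G$ (two distinct edges that share an end have distinct colours) in which every edge $uv$ receives a colour from $\{1,2,\dots,1+\max\{d(u),d(v)\}\}$, where $d(w)$ denotes the degree of the vertex $w$ in $G$. -/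

import Mathlib

/-!
A word random access machine with structured programs. A state consists of registers and of a
random access memory, whose cells hold natural numbers. Every operation, register access, memory
access and test costs one unit of time, and every number that occurs in a run has to fit into a
machine word.
-/

namespace WordRAM

/-- Binary word operations; comparisons return `1` for true and `0` for false. -/
inductive Op where
  | add | sub | mul | lt | eq

/-- The value of an operation; subtraction is truncated at `0`. -/
def Op.eval : Op → ℕ → ℕ → ℕ
  | .add, a, b => a + b
  | .sub, a, b => a - b
  | .mul, a, b => a * b
  | .lt, a, b => if a < b then 1 else 0
  | .eq, a, b => if a = b then 1 else 0

/-- Expressions: constants, registers, memory cells with a computed address, operations. -/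
inductive Expr where
  | const (k : ℕ)
  | reg (i : ℕ)
  | load (addr : Expr)
  | op (o : Op) (a b : Expr)

/-- Programs; `loop e p` is "while `e` do `p`". A test succeeds if the value of its expression is not `0`. -/
inductive Prog where
  | skip
  | set (i : ℕ) (e : Expr)
  | store (addr e : Expr)
  | seq (p q : Prog)
  | ite (e : Expr) (p q : Prog)
  | loop (e : Expr) (p : Prog)

/-- A machine state: the contents of the registers and of the memory. -/
structure State where
  reg : ℕ → ℕ
  mem : ℕ → ℕ

namespace Expr

/-- The value of an expression. -/
def eval (s : State) : Expr → ℕ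
  | const k => k
  | reg i => s.reg i
  | load a => s.mem (a.eval s)
  | op o a b => o.eval (a.eval s) (b.eval s)

/-- The time to evaluate an expression: one unit for each constant, register access, memory
access and operation in it. -/
def cost : Expr → ℕ
  | const _ => 1
  | reg _ => 1
  | load a => a.cost + 1
  | op _ a b => a.cost + b.cost + 1

/-- All values that occur in the evaluation of the expression, memory addresses included, are
words, that is, less than `W`. -/
def Fits (W : ℕ) (s : State) : Expr → Prop
  | const k => k < W
  | reg i => s.reg i < W
  | load a => a.Fits W s ∧ s.mem (a.eval s) < W
  | op o a b => a.Fits W s ∧ b.Fits W s ∧ o.eval (a.eval s) (b.eval s) < W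

end Expr

/-- `Exec W p s s' t`: on a machine whose words are the numbers less than `W`, the program `p`
started in the state `s` halts in the state `s'` after exactly `t` units of time. A run in which
a number `≥ W` occurs gets stuck, that is, it has no execution. -/
inductive Exec (W : ℕ) : Prog → State → State → ℕ → Prop
  | skip (s : State) : Exec W .skip s s 1
  | set (s : State) (i : ℕ) (e : Expr) (he : e.Fits W s) :
      Exec W (.set i e) s ⟨Function.update s.reg i (e.eval s), s.mem⟩ (e.cost + 1)
  | store (s : State) (a e : Expr) (ha : a.Fits W s) (he : e.Fits W s) :
      Exec W (.store a e) s ⟨s.reg, Function.update s.mem (a.eval s) (e.eval s)⟩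
        (a.cost + e.cost + 1)
  | seq {p q : Prog} {s s₁ s₂ : State} {t₁ t₂ : ℕ}
      (hp : Exec W p s s₁ t₁) (hq : Exec W q s₁ s₂ t₂) :
      Exec W (.seq p q) s s₂ (t₁ + t₂)
  | ite_true {e : Expr} {p q : Prog} {s s₁ : State} {t : ℕ} (he : e.Fits W s)
      (h : e.eval s ≠ 0) (hp : Exec W p s s₁ t) :
      Exec W (.ite e p q) s s₁ (e.cost + 1 + t)
  | ite_false {e : Expr} {p q : Prog} {s s₁ : State} {t : ℕ} (he : e.Fits W s)
      (h : e.eval s = 0) (hq : Exec W q s s₁ t) :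
      Exec W (.ite e p q) s s₁ (e.cost + 1 + t)
  | loop_true {e : Expr} {p : Prog} {s s₁ s₂ : State} {t₁ t₂ : ℕ} (he : e.Fits W s)
      (h : e.eval s ≠ 0) (hp : Exec W p s s₁ t₁) (hw : Exec W (.loop e p) s₁ s₂ t₂) :
      Exec W (.loop e p) s s₂ (e.cost + 1 + t₁ + t₂)
  | loop_false {e : Expr} {p : Prog} {s : State} (he : e.Fits W s) (h : e.eval s = 0) :
      Exec W (.loop e p) s s (e.cost + 1)

/-- The machine is deterministic: the final state and the running time are determined by the
program and the initial state. -/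
theorem Exec.deterministic {W : ℕ} {p : Prog} {s s₁ : State} {t₁ : ℕ}
    (h₁ : Exec W p s s₁ t₁) : ∀ {s₂ : State} {t₂ : ℕ}, Exec W p s s₂ t₂ → s₁ = s₂ ∧ t₁ = t₂ := by
  induction h₁ with
  | skip s => intro s₂ t₂ h; cases h; exact ⟨rfl, rfl⟩
  | set s i e he => intro s₂ t₂ h; cases h; exact ⟨rfl, rfl⟩
  | store s a e ha he => intro s₂ t₂ h; cases h; exact ⟨rfl, rfl⟩
  | seq _ _ ih₁ ih₂ =>
    intro s₂ t₂ h
    cases h with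
    | seq hp hq =>
      obtain ⟨rfl, rfl⟩ := ih₁ hp
      obtain ⟨rfl, rfl⟩ := ih₂ hq
      exact ⟨rfl, rfl⟩
  | ite_true he hne _ ih =>
    intro s₂ t₂ h
    cases h with
    | ite_true _ _ hp => obtain ⟨rfl, rfl⟩ := ih hp; exact ⟨rfl, rfl⟩
    | ite_false _ h0 _ => exact absurd h0 hne
  | ite_false he h0 _ ih =>
    intro s₂ t₂ h
    cases h with
    | ite_true _ hne _ => exact absurd h0 hne
    | ite_false _ _ hq => obtain ⟨rfl, rfl⟩ := ih hq; exact ⟨rfl, rfl⟩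
  | loop_true he hne _ _ ih₁ ih₂ =>
    intro s₂ t₂ h
    cases h with
    | loop_true _ _ hp hw =>
      obtain ⟨rfl, rfl⟩ := ih₁ hp
      obtain ⟨rfl, rfl⟩ := ih₂ hw
      exact ⟨rfl, rfl⟩
    | loop_false _ h0 => exact absurd h0 hne
  | loop_false he h0 =>
    intro s₂ t₂ h
    cases h with
    | loop_true _ hne _ _ => exact absurd h0 hne
    | loop_false _ _ => exact ⟨rfl, rfl⟩

end WordRAM

/-- `es` lists every edge of `G` exactly once, in any order and with its two ends in any order. -/
def IsEdgeList {n : ℕ} (G : SimpleGraph (Fin n)) (es : List (Fin n × Fin n)) : Prop :=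
  (es.map fun p => s(p.1, p.2)).Nodup ∧
    ∀ e : Sym2 (Fin n), e ∈ es.map (fun p => s(p.1, p.2)) ↔ e ∈ G.edgeSet

/-- The input state for a graph on `n` vertices `0, …, n - 1` with edge list `es` of length `m`:
register `0` holds `n`, register `1` holds `m`, and the memory cells `2 * j` and `2 * j + 1` hold
the two ends of the `j`-th edge, for `j < m`. Everything else is `0`. -/
def edgeListInput (n : ℕ) (es : List (Fin n × Fin n)) : WordRAM.State where
  reg i := if i = 0 then n else if i = 1 then es.length else 0
  mem a := (es.flatMap fun p => [(p.1 : ℕ), (p.2 : ℕ)]).getD a 0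

/-- A proper edge colouring `c` of `G`, with colours in `ℕ`, is strictly local if every edge `uv`
has a colour in `{1, …, 1 + max {d(u), d(v)}}`. -/
def IsStrictlyLocal {n : ℕ} (G : SimpleGraph (Fin n)) [DecidableRel G.Adj]
    (c : G.lineGraph.Coloring ℕ) : Prop :=
  ∀ (u v : Fin n) (h : G.Adj u v),
    c ⟨s(u, v), h⟩ ∈ Finset.Icc 1 (1 + max (G.degree u) (G.degree v))

/-- The state `s` displays the colouring `c` of the edges listed in `es`: the colour of the `j`-th
edge is in the memory cell `2 * m + j`, behind the cells of the input, where `m` is the number of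
edges. -/
def DisplaysColouring {n : ℕ} (G : SimpleGraph (Fin n)) (es : List (Fin n × Fin n))
    (c : G.lineGraph.Coloring ℕ) (s : WordRAM.State) : Prop :=
  ∀ (j : ℕ) (hj : j < es.length) (e : G.edgeSet), (e : Sym2 (Fin n)) = s(es[j].1, es[j].2) →
    s.mem (2 * es.length + j) = c e

/-! Colours are numbered from `0`; call a colour `c` small at `v` if `c ≤ d(v)`, with degrees taken
in the whole graph. At most `d(v)` coloured edges meet `v`, so `v` always misses a small colour, and
one such colour is stored for each vertex. Edges are inserted one by one as a hole, an edge without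
colour, and a Vizing-type step closes the hole or replaces it by another one.

For a hole `xy`, build a fan `Y 0 = y, Y 1, …`: the edge from `x` to `Y (i + 1)` has the stored
missing colour of `Y i`. Shifting the hole along the fan is always admissible, since the colour
given to `x Y i` is small at `Y i`. If the fan ends with a colour missing at `x`, that colour closes
the hole. Otherwise two fan vertices `Y s` and `Y k` with `s < k` miss the same colour `δ`. Shift
the hole to `Y s`, let `α` be the missing colour of `x`, remove `δ` from the edge `x Y (s + 1)`, and
push the second hole so created along the alternating `α`-`δ` path.

The path can get stuck at a hole `uv` when the colour `b` intended for the next edge is not small at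
either of its ends. The hole is then left there and `x Y s` is closed with `δ`. The same closure
works when the path ends away from `Y s`. If it ends at `Y s`, the hole is shifted on to `Y k`,
where `δ` is still missing.

Progress is measured by the potential, the number of pairs of a vertex and a small colour present
there; it is at most the sum of the degrees, `2m`. Every step raises it: a stuck hole costs nothing
at `v`, because `b` is not small there. A step takes time `O(n)` per unit of gain. The delicate
point is that a shift may visit many vertices, each of which needs a new missing colour. The colour
just taken from a vertex serves, unless it is not small there, and then the move has raised the
potential by one, which pays for a search of length `O(n)`. The total is `O(nm)`, hence `O(n²Δ)`.

The argument is carried by `moved`, `Shifted.next`, `Walk.next`, `turn_vc` and `step_vc`. Word size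
is treated separately in `Run.exec`: stored values exceed the initial ones by at most the running
time, so the bound on time also bounds all numbers. -/

namespace WordRAM

/-! ### Growth of numbers in a run -/

/-- Executions of a machine with unbounded words. -/
inductive Run : Prog → State → State → ℕ → Prop
  | skip (s : State) : Run .skip s s 1
  | set (s : State) (i : ℕ) (e : Expr) :
      Run (.set i e) s ⟨Function.update s.reg i (e.eval s), s.mem⟩ (e.cost + 1)
  | store (s : State) (a e : Expr) :
      Run (.store a e) s ⟨s.reg, Function.update s.mem (a.eval s) (e.eval s)⟩
        (a.cost + e.cost + 1)
  | seq {p q : Prog} {s s₁ s₂ : State} {t₁ t₂ : ℕ}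
      (hp : Run p s s₁ t₁) (hq : Run q s₁ s₂ t₂) : Run (.seq p q) s s₂ (t₁ + t₂)
  | ite_true {e : Expr} {p q : Prog} {s s₁ : State} {t : ℕ}
      (h : e.eval s ≠ 0) (hp : Run p s s₁ t) : Run (.ite e p q) s s₁ (e.cost + 1 + t)
  | ite_false {e : Expr} {p q : Prog} {s s₁ : State} {t : ℕ}
      (h : e.eval s = 0) (hq : Run q s s₁ t) : Run (.ite e p q) s s₁ (e.cost + 1 + t)
  | loop_true {e : Expr} {p : Prog} {s s₁ s₂ : State} {t₁ t₂ : ℕ}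
      (h : e.eval s ≠ 0) (hp : Run p s s₁ t₁) (hw : Run (.loop e p) s₁ s₂ t₂) :
      Run (.loop e p) s s₂ (e.cost + 1 + t₁ + t₂)
  | loop_false {e : Expr} {p : Prog} {s : State} (h : e.eval s = 0) :
      Run (.loop e p) s s (e.cost + 1)

namespace Expr

/-- The number of leaves of an expression, an exponent that bounds its values. -/
def weight : Expr → ℕ
  | const _ => 1
  | reg _ => 1
  | load a => a.weight
  | op _ a b => a.weight + b.weight

/-- All constants are at most `8` and there are at most `K` leaves. -/
def smallConsts : Expr → Bool
  | const k => decide (k ≤ 8)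
  | reg _ => true
  | load a => a.smallConsts
  | op _ a b => a.smallConsts && b.smallConsts

/-- Expressions whose value exceeds the largest number in the state by at most their cost. -/
def tame : Expr → Bool
  | const k => decide (k ≤ 1)
  | reg _ => true
  | load _ => true
  | op .add a (const k) => a.tame && decide (k ≤ 1)
  | op .sub a _ => a.tame
  | op .lt _ _ => true
  | op .eq _ _ => true
  | op _ _ _ => false

end Expr

/-- All numbers in the state are at most `B`. -/
def State.BoundedBy (s : State) (B : ℕ) : Prop :=
  (∀ i, s.reg i ≤ B) ∧ ∀ a, s.mem a ≤ B

theorem Expr.weight_pos : ∀ e : Expr, 0 < e.weight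
  | .const _ => Nat.one_pos
  | .reg _ => Nat.one_pos
  | .load a => a.weight_pos
  | .op _ a _ => Nat.add_pos_left a.weight_pos _

theorem Op.eval_le {V p q : ℕ} (hV : 2 ≤ V) (hp : 0 < p) (hq : 0 < q) (o : Op) {a b : ℕ}
    (ha : a ≤ V ^ p) (hb : b ≤ V ^ q) : o.eval a b ≤ V ^ (p + q) := by
  have h1 : V ≤ V ^ p := Nat.le_self_pow hp.ne' V
  have h2 : V ≤ V ^ q := Nat.le_self_pow hq.ne' V
  rw [pow_add]
  cases o <;> simp only [Op.eval]
  · nlinarith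
  · nlinarith [Nat.sub_le a b]
  · exact Nat.mul_le_mul ha hb
  · split_ifs <;> nlinarith
  · split_ifs <;> nlinarith

theorem Expr.eval_le_pow {s : State} {B V : ℕ} (hs : s.BoundedBy B) (hV : 8 ≤ V) (hB : B ≤ V) :
    ∀ e : Expr, e.smallConsts → e.eval s ≤ V ^ e.weight
  | .const k, h => by
    simp only [smallConsts, decide_eq_true_eq] at h
    simp only [eval, weight, pow_one]; omega
  | .reg i, _ => by simpa [eval, weight] using (hs.1 i).trans hB
  | .load a, _ => ((hs.2 _).trans hB).trans (Nat.le_self_pow a.weight_pos.ne' V)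
  | .op o a b, h => by
    simp only [smallConsts, Bool.and_eq_true] at h
    exact Op.eval_le (by omega) a.weight_pos b.weight_pos o
      (eval_le_pow hs hV hB a h.1) (eval_le_pow hs hV hB b h.2)

theorem Expr.fits_of_bounded {s : State} {B V W : ℕ} (hs : s.BoundedBy B) (hV : 8 ≤ V)
    (hB : B ≤ V) : ∀ e : Expr, e.smallConsts → V ^ e.weight < W → e.Fits W s
  | .const k, h, hW => lt_of_le_of_lt (eval_le_pow hs hV hB (.const k) h) hW
  | .reg i, h, hW => lt_of_le_of_lt (eval_le_pow hs hV hB (.reg i) h) hW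
  | .load a, h, hW =>
    ⟨fits_of_bounded hs hV hB a h hW, lt_of_le_of_lt (eval_le_pow hs hV hB (.load a) h) hW⟩
  | .op o a b, h, hW => by
    have h' := h
    simp only [smallConsts, Bool.and_eq_true] at h'
    refine ⟨fits_of_bounded hs hV hB a h'.1 ?_, fits_of_bounded hs hV hB b h'.2 ?_,
      lt_of_le_of_lt (eval_le_pow hs hV hB (.op o a b) h) hW⟩
    · exact lt_of_le_of_lt (Nat.pow_le_pow_right (by omega) (by simp [weight])) hW
    · exact lt_of_le_of_lt (Nat.pow_le_pow_right (by omega) (by simp [weight])) hW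

/-- An allowed addition contributes at most `1` and costs at least one unit. Products occur only
inside addresses and comparisons, whose size does not reach the value, or in a subtracted term. -/
theorem Expr.eval_le_of_tame {s : State} {B : ℕ} (hs : s.BoundedBy B) (e : Expr) (he : e.tame) :
    e.eval s ≤ B + e.cost := by
  induction e with
  | const k => simp only [tame, decide_eq_true_eq] at he; simp only [eval, cost]; omega
  | reg i => have := hs.1 i; simp only [eval, cost]; omega
  | load a _ => have := hs.2 (a.eval s); simp only [eval, cost]; omega
  | op o a b iha _ =>
    cases o with
    | add =>
      cases b with
      | const k =>
        simp only [tame, Bool.and_eq_true, decide_eq_true_eq] at he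
        have := iha he.1
        simp only [eval, cost, Op.eval]; omega
      | _ => simp [tame] at he
    | sub =>
      have := iha (by simpa [tame] using he)
      simp only [eval, cost, Op.eval]; omega
    | mul => simp [tame] at he
    | lt => simp only [eval, cost, Op.eval]; split_ifs <;> omega
    | eq => simp only [eval, cost, Op.eval]; split_ifs <;> omega

/-- Expressions are small, and only slowly growing values are stored. -/
def Prog.Tame (K : ℕ) : Prog → Bool
  | .skip => true
  | .set _ e => e.smallConsts && decide (e.weight ≤ K) && e.tame
  | .store a e => a.smallConsts && decide (a.weight ≤ K) && (e.smallConsts &&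
      decide (e.weight ≤ K) && e.tame)
  | .seq p q => p.Tame K && q.Tame K
  | .ite e p q => e.smallConsts && decide (e.weight ≤ K) && (p.Tame K && q.Tame K)
  | .loop e p => e.smallConsts && decide (e.weight ≤ K) && p.Tame K

theorem State.BoundedBy.mono {s : State} {B B' : ℕ} (h : s.BoundedBy B) (hB : B ≤ B') :
    s.BoundedBy B' :=
  ⟨fun i => (h.1 i).trans hB, fun a => (h.2 a).trans hB⟩

/-- The numbers in a run of a tame program grow at most as fast as the running time, so that the
run is possible on a machine with large enough words. -/
theorem Run.exec {K W : ℕ} {p : Prog} {s s' : State} {t : ℕ} (h : Run p s s' t) :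
    ∀ {B : ℕ}, p.Tame K → s.BoundedBy B → (B + t + 8) ^ K < W →
      Exec W p s s' t ∧ s'.BoundedBy (B + t) := by
  -- The base `B + t + 8` dominates the numbers in the state and all constants; the exponent `K`
  -- bounds the number of leaves, so intermediate products fit as well.
  have fits : ∀ {s : State} {B t : ℕ} {e : Expr}, s.BoundedBy B → e.smallConsts = true →
      e.weight ≤ K → (B + t + 8) ^ K < W → e.Fits W s := fun {s B t e} hs hc hw hW =>
    Expr.fits_of_bounded hs (V := B + t + 8) (by omega) (by omega) e hc
      (lt_of_le_of_lt (Nat.pow_le_pow_right (by omega) hw) hW)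
  have shrink : ∀ {B t B' t' : ℕ}, B' + t' ≤ B + t → (B + t + 8) ^ K < W →
      (B' + t' + 8) ^ K < W := fun h hW => lt_of_le_of_lt (Nat.pow_le_pow_left (by omega) K) hW
  induction h with
  | skip s => intro B _ hs _; exact ⟨.skip s, hs.mono (by omega)⟩
  | set s i e =>
    intro B hp hs hW
    simp only [Prog.Tame, Bool.and_eq_true, decide_eq_true_eq] at hp
    refine ⟨.set s i e (fits hs hp.1.1 hp.1.2 hW), fun j => ?_, fun a => (hs.2 a).trans (by omega)⟩
    have := e.eval_le_of_tame hs hp.2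
    have := hs.1 j
    simp only [Function.update_apply]
    split_ifs <;> omega
  | store s a e =>
    intro B hp hs hW
    simp only [Prog.Tame, Bool.and_eq_true, decide_eq_true_eq] at hp
    refine ⟨.store s a e (fits hs hp.1.1 hp.1.2 hW) (fits hs hp.2.1.1 hp.2.1.2 hW),
      fun j => (hs.1 j).trans (by omega), fun j => ?_⟩
    have := e.eval_le_of_tame hs hp.2.2
    have := hs.2 j
    simp only [Function.update_apply]
    split_ifs <;> omega
  | seq _ _ ih₁ ih₂ =>
    intro B hp hs hW
    simp only [Prog.Tame, Bool.and_eq_true] at hp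
    obtain ⟨h₁, hb₁⟩ := ih₁ hp.1 hs (shrink (by omega) hW)
    obtain ⟨h₂, hb₂⟩ := ih₂ hp.2 hb₁ (shrink (by omega) hW)
    exact ⟨.seq h₁ h₂, hb₂.mono (by omega)⟩
  | ite_true hne _ ih =>
    intro B hp hs hW
    simp only [Prog.Tame, Bool.and_eq_true, decide_eq_true_eq] at hp
    obtain ⟨h₁, hb₁⟩ := ih hp.2.1 hs (shrink (by omega) hW)
    exact ⟨.ite_true (fits hs hp.1.1 hp.1.2 hW) hne h₁, hb₁.mono (by omega)⟩
  | ite_false h0 _ ih =>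
    intro B hp hs hW
    simp only [Prog.Tame, Bool.and_eq_true, decide_eq_true_eq] at hp
    obtain ⟨h₁, hb₁⟩ := ih hp.2.2 hs (shrink (by omega) hW)
    exact ⟨.ite_false (fits hs hp.1.1 hp.1.2 hW) h0 h₁, hb₁.mono (by omega)⟩
  | loop_true hne _ _ ih₁ ih₂ =>
    intro B hp hs hW
    have hp' := hp
    simp only [Prog.Tame, Bool.and_eq_true, decide_eq_true_eq] at hp
    obtain ⟨h₁, hb₁⟩ := ih₁ hp.2 hs (shrink (by omega) hW)
    obtain ⟨h₂, hb₂⟩ := ih₂ hp' hb₁ (shrink (by omega) hW)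
    exact ⟨.loop_true (fits hs hp.1.1 hp.1.2 hW) hne h₁ h₂, hb₂.mono (by omega)⟩
  | loop_false h0 =>
    intro B hp hs hW
    simp only [Prog.Tame, Bool.and_eq_true, decide_eq_true_eq] at hp
    exact ⟨.loop_false (fits hs hp.1.1 hp.1.2 hW) h0, hs.mono (by omega)⟩

/-! ### A language with arrays -/

/-- A structured view of a state: registers, the cells below `3 * m` (where `m` is the content of
register `1`), four arrays, and a table with two indices. -/
structure Store where
  r : ℕ → ℕ
  low : ℕ → ℕ
  deg : ℕ → ℕ
  miss : ℕ → ℕ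
  mark : ℕ → ℕ
  par : ℕ → ℕ
  nbr : ℕ → ℕ → ℕ

/-- The content of the cell `5 * q + i` behind the first `3 * m` cells. -/
def Store.high (σ : Store) (q : ℕ) : ℕ → ℕ
  | 0 => σ.deg q
  | 1 => σ.miss q
  | 2 => σ.mark q
  | 3 => σ.par q
  | _ => if q - q.sqrt * q.sqrt ≤ q.sqrt then
      σ.nbr (q - q.sqrt * q.sqrt) (q.sqrt - (q - q.sqrt * q.sqrt)) else 0

/-- The machine state that a store describes. -/
def Store.state (σ : Store) : State where
  reg := σ.r
  mem a := if a < 3 * σ.r 1 then σ.low a else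
    σ.high ((a - 3 * σ.r 1) / 5) ((a - 3 * σ.r 1) % 5)

/-- The number of the cell of a table that belongs to the indices `v` and `c`. -/
def tableIndex (v c : ℕ) : ℕ := (v + c) * (v + c) + v

/-- The excess `v` over the square `(v + c)²` is at most `2 (v + c)`, so both indices can be
recovered. This pairing gives the table unbounded dimensions without any allocation. -/
theorem sqrt_tableIndex (v c : ℕ) : (tableIndex v c).sqrt = v + c :=
  Nat.sqrt_add_eq _ (by omega)

theorem tableIndex_sub (v c : ℕ) : tableIndex v c - (v + c) * (v + c) = v := by
  simp [tableIndex]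

theorem tableIndex_of_sqrt {q : ℕ} (h : q - q.sqrt * q.sqrt ≤ q.sqrt) :
    tableIndex (q - q.sqrt * q.sqrt) (q.sqrt - (q - q.sqrt * q.sqrt)) = q := by
  have := Nat.sqrt_le q
  rw [tableIndex, show q - q.sqrt * q.sqrt + (q.sqrt - (q - q.sqrt * q.sqrt)) = q.sqrt by omega]
  omega

/-- Replace the entry with indices `v` and `c` of a table. -/
def setEntry (f : ℕ → ℕ → ℕ) (v c w : ℕ) : ℕ → ℕ → ℕ :=
  fun v' c' => if v' = v ∧ c' = c then w else f v' c'

/-- Expressions that read registers, arrays and the table. -/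
inductive AExpr where
  | const (k : ℕ)
  | reg (i : ℕ)
  | low (e : AExpr)
  | deg (e : AExpr)
  | miss (e : AExpr)
  | mark (e : AExpr)
  | par (e : AExpr)
  | nbr (v c : AExpr)
  | op (o : Op) (a b : AExpr)

namespace AExpr

/-- The value of an expression. -/
def eval (σ : Store) : AExpr → ℕ
  | const k => k
  | reg i => σ.r i
  | low e => if e.eval σ < 3 * σ.r 1 then σ.low (e.eval σ) else σ.state.mem (e.eval σ)
  | deg e => σ.deg (e.eval σ)
  | miss e => σ.miss (e.eval σ)
  | mark e => σ.mark (e.eval σ)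
  | par e => σ.par (e.eval σ)
  | nbr v c => σ.nbr (v.eval σ) (c.eval σ)
  | op o a b => o.eval (a.eval σ) (b.eval σ)

end AExpr

/-- The address of the `e`-th cell of the `i`-th array. -/
def cellExpr (i : ℕ) (e : Expr) : Expr :=
  .op .add (.op .mul (.const 3) (.reg 1)) (.op .add (.op .mul (.const 5) e) (.const i))

/-- The index of an entry of the table. -/
def tableExpr (v c : Expr) : Expr :=
  .op .add (.op .mul (.op .add v c) (.op .add v c)) v

namespace AExpr

/-- Translation into machine expressions. -/
def compile : AExpr → Expr
  | const k => .const k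
  | reg i => .reg i
  | low e => .load e.compile
  | deg e => .load (cellExpr 0 e.compile)
  | miss e => .load (cellExpr 1 e.compile)
  | mark e => .load (cellExpr 2 e.compile)
  | par e => .load (cellExpr 3 e.compile)
  | nbr v c => .load (cellExpr 4 (tableExpr v.compile c.compile))
  | op o a b => .op o a.compile b.compile

/-- The time to evaluate an expression. -/
def cost : AExpr → ℕ
  | const _ => 1
  | reg _ => 1
  | low e => e.cost + 1
  | deg e => e.cost + 9
  | miss e => e.cost + 9
  | mark e => e.cost + 9
  | par e => e.cost + 9
  | nbr v c => 3 * v.cost + 2 * c.cost + 13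
  | op _ a b => a.cost + b.cost + 1

theorem cost_compile (e : AExpr) : e.compile.cost = e.cost := by
  induction e <;> simp_all [compile, cost, Expr.cost, cellExpr, tableExpr] <;> ring

end AExpr

theorem Store.mem_cell (σ : Store) (i q : ℕ) (hi : i < 5) :
    σ.state.mem (3 * σ.r 1 + (5 * q + i)) = σ.high q i := by
  simp only [Store.state]
  rw [if_neg (by omega), show (3 * σ.r 1 + (5 * q + i) - 3 * σ.r 1) = 5 * q + i by omega,
    show (5 * q + i) / 5 = q by omega, show (5 * q + i) % 5 = i by omega]

/-- `low` falls back on the machine memory outside its range, so the equality needs no bound on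
addresses. -/
theorem AExpr.eval_compile (σ : Store) (e : AExpr) : e.compile.eval σ.state = e.eval σ := by
  induction e with
  | const k => rfl
  | reg i => rfl
  | low e ih =>
    simp only [compile, eval, Expr.eval, ih]
    split_ifs with h
    · simp [Store.state, h]
    · rfl
  | deg e ih =>
    simp only [compile, eval, Expr.eval, cellExpr, ih, Op.eval]
    exact σ.mem_cell 0 _ (by omega)
  | miss e ih =>
    simp only [compile, eval, Expr.eval, cellExpr, ih, Op.eval]
    exact σ.mem_cell 1 _ (by omega)
  | mark e ih =>
    simp only [compile, eval, Expr.eval, cellExpr, ih, Op.eval]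
    exact σ.mem_cell 2 _ (by omega)
  | par e ih =>
    simp only [compile, eval, Expr.eval, cellExpr, ih, Op.eval]
    exact σ.mem_cell 3 _ (by omega)
  | nbr v c ihv ihc =>
    simp only [compile, eval, Expr.eval, cellExpr, tableExpr, ihv, ihc, Op.eval]
    refine (σ.mem_cell 4 (tableIndex (v.eval σ) (c.eval σ)) (by omega)).trans ?_
    simp only [Store.high, sqrt_tableIndex, tableIndex_sub]
    rw [if_pos (by omega), show v.eval σ + c.eval σ - v.eval σ = c.eval σ by omega]
  | op o a b iha ihb => simp only [compile, eval, Expr.eval, iha, ihb]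

/-! ### Array programs and their verification conditions -/

/-- Programs of the language with arrays. -/
inductive Cmd where
  | skip
  | set (i : ℕ) (e : AExpr)
  | setLow (a e : AExpr)
  | setDeg (a e : AExpr)
  | setMiss (a e : AExpr)
  | setMark (a e : AExpr)
  | setPar (a e : AExpr)
  | setNbr (v c e : AExpr)
  | seq (p q : Cmd)
  | ite (e : AExpr) (p q : Cmd)
  | loop (e : AExpr) (p : Cmd)

/-- Translation into machine programs. -/
def Cmd.compile : Cmd → Prog
  | skip => .skip
  | set i e => .set i e.compile
  | setLow a e => .store a.compile e.compile
  | setDeg a e => .store (cellExpr 0 a.compile) e.compile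
  | setMiss a e => .store (cellExpr 1 a.compile) e.compile
  | setMark a e => .store (cellExpr 2 a.compile) e.compile
  | setPar a e => .store (cellExpr 3 a.compile) e.compile
  | setNbr v c e => .store (cellExpr 4 (tableExpr v.compile c.compile)) e.compile
  | seq p q => .seq p.compile q.compile
  | ite e p q => .ite e.compile p.compile q.compile
  | loop e p => .loop e.compile p.compile

/-- The program halts in a store and after a time that satisfy `Q`. -/
def Cmd.Runs (p : Cmd) (σ : Store) (Q : Store → ℕ → Prop) : Prop :=
  ∃ σ' t, Run p.compile σ.state σ'.state t ∧ Q σ' t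

/-- A sufficient condition for `Cmd.Runs` that is computed by symbolic execution up to loops. -/
def Cmd.vc : Cmd → Store → (Store → ℕ → Prop) → Prop
  | skip, σ, Q => Q σ 1
  | set i e, σ, Q => i ≠ 1 ∧ Q { σ with r := Function.update σ.r i (e.eval σ) } (e.cost + 1)
  | setLow a e, σ, Q => a.eval σ < 3 * σ.r 1 ∧
      Q { σ with low := Function.update σ.low (a.eval σ) (e.eval σ) } (a.cost + e.cost + 1)
  | setDeg a e, σ, Q =>
      Q { σ with deg := Function.update σ.deg (a.eval σ) (e.eval σ) } (a.cost + e.cost + 9)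
  | setMiss a e, σ, Q =>
      Q { σ with miss := Function.update σ.miss (a.eval σ) (e.eval σ) } (a.cost + e.cost + 9)
  | setMark a e, σ, Q =>
      Q { σ with mark := Function.update σ.mark (a.eval σ) (e.eval σ) } (a.cost + e.cost + 9)
  | setPar a e, σ, Q =>
      Q { σ with par := Function.update σ.par (a.eval σ) (e.eval σ) } (a.cost + e.cost + 9)
  | setNbr v c e, σ, Q =>
      Q { σ with nbr := setEntry σ.nbr (v.eval σ) (c.eval σ) (e.eval σ) }
        (3 * v.cost + 2 * c.cost + e.cost + 13)
  | seq p q, σ, Q => p.vc σ fun σ₁ t₁ => q.vc σ₁ fun σ₂ t₂ => Q σ₂ (t₁ + t₂)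
  | ite e p q, σ, Q => (e.eval σ ≠ 0 → p.vc σ fun σ₁ t => Q σ₁ (e.cost + 1 + t)) ∧
      (e.eval σ = 0 → q.vc σ fun σ₁ t => Q σ₁ (e.cost + 1 + t))
  | loop e p, σ, Q => (loop e p).Runs σ Q

/-- Quotient and remainder modulo `5` decode an address beyond the first `3 * m` cells uniquely, so
the interleaved arrays do not interfere. -/
theorem Store.update_cell (σ τ : Store) (i q w : ℕ) (hi : i < 5) (hr : τ.r = σ.r)
    (hl : τ.low = σ.low) (hq : τ.high q i = w)
    (hh : ∀ q' i', ¬(q' = q ∧ i' = i) → i' < 5 → τ.high q' i' = σ.high q' i') :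
    (⟨σ.state.reg, Function.update σ.state.mem (3 * σ.r 1 + (5 * q + i)) w⟩ : State) = τ.state := by
  simp only [Store.state, hr, hl, State.mk.injEq, true_and]
  funext a
  rw [Function.update_apply]
  split_ifs with h h' h'
  · omega
  · rw [h, show 3 * σ.r 1 + (5 * q + i) - 3 * σ.r 1 = 5 * q + i by omega,
      show (5 * q + i) / 5 = q by omega, show (5 * q + i) % 5 = i by omega, hq]
  · rfl
  · exact (hh _ _ (by omega) (Nat.mod_lt _ (by omega))).symm

theorem Store.update_nbr (σ : Store) (v c w : ℕ) :
    (⟨σ.state.reg, Function.update σ.state.mem (3 * σ.r 1 + (5 * tableIndex v c + 4)) w⟩ : State) =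
      Store.state { σ with nbr := setEntry σ.nbr v c w } := by
  refine σ.update_cell _ 4 _ w (by omega) rfl rfl ?_ ?_
  · simp only [Store.high, sqrt_tableIndex, tableIndex_sub]
    rw [if_pos (by omega), show v + c - v = c by omega]
    simp [setEntry]
  · intro q i hne hi
    match i, hi with
    | 0, _ => rfl
    | 1, _ => rfl
    | 2, _ => rfl
    | 3, _ => rfl
    | 4, _ =>
      simp only [Store.high]
      split_ifs with h
      · simp only [setEntry]
        rw [if_neg]
        -- Indices that do not come from a pair read as `0`; on the others the pairing is injective.
        rintro ⟨h1, h2⟩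
        exact hne ⟨by rw [← h1, ← h2, tableIndex_of_sqrt h], rfl⟩
      · rfl

theorem Store.run_cell (σ τ : Store) (i : ℕ) (a : Expr) (e : AExpr) (hi : i < 5)
    (hr : τ.r = σ.r) (hl : τ.low = σ.low) (hq : τ.high (a.eval σ.state) i = e.eval σ)
    (hh : ∀ q i', ¬(q = a.eval σ.state ∧ i' = i) → i' < 5 → τ.high q i' = σ.high q i') :
    Run (.store (cellExpr i a) e.compile) σ.state τ.state (a.cost + e.cost + 9) := by
  have h := Run.store σ.state (cellExpr i a) e.compile
  rw [AExpr.eval_compile] at h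
  rw [show a.cost + e.cost + 9 = (cellExpr i a).cost + e.compile.cost + 1 by
    rw [AExpr.cost_compile]; simp only [cellExpr, Expr.cost]; omega]
  have h' := σ.update_cell τ i (a.eval σ.state) (e.eval σ) hi hr hl hq hh
  rw [← h']
  exact h

theorem Cmd.runs_of_vc (p : Cmd) : ∀ (σ : Store) (Q : Store → ℕ → Prop), p.vc σ Q → p.Runs σ Q := by
  induction p with
  | skip => exact fun σ Q h => ⟨σ, 1, .skip _, h⟩
  | set i e =>
    rintro σ Q ⟨hi, h⟩
    refine ⟨_, _, ?_, h⟩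
    have := Run.set σ.state i e.compile
    rw [AExpr.eval_compile, AExpr.cost_compile] at this
    -- Register `1` fixes where the arrays begin, so an assignment keeps the memory layout only
    -- because `i ≠ 1`.
    have hs : Store.state { σ with r := Function.update σ.r i (e.eval σ) } =
        ⟨Function.update σ.state.reg i (e.eval σ), σ.state.mem⟩ := by
      simp only [Store.state, Function.update_of_ne hi.symm]
      rfl
    rw [hs]
    exact this
  | setLow a e =>
    rintro σ Q ⟨ha, h⟩
    refine ⟨_, _, ?_, h⟩
    have := Run.store σ.state a.compile e.compile
    rw [AExpr.eval_compile, AExpr.eval_compile, AExpr.cost_compile, AExpr.cost_compile] at this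
    convert this using 1
    · rfl
    simp only [Store.state, State.mk.injEq, true_and]
    funext b
    simp only [Function.update_apply]
    split_ifs with h1 h2 h2
    · rfl
    · rfl
    · omega
    · rfl
  | setDeg a e =>
    intro σ Q h
    refine ⟨_, _, ?_, h⟩
    have ha := AExpr.eval_compile σ a
    rw [← AExpr.cost_compile a]
    refine σ.run_cell _ 0 a.compile e (by omega) rfl rfl (by simp [Store.high, ha]) ?_
    intro q i hne hi
    match i, hi with
    | 0, _ => exact Function.update_of_ne (by omega) _ _
    | 1, _ => rfl
    | 2, _ => rfl
    | 3, _ => rfl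
    | 4, _ => rfl
  | setMiss a e =>
    intro σ Q h
    refine ⟨_, _, ?_, h⟩
    have ha := AExpr.eval_compile σ a
    rw [← AExpr.cost_compile a]
    refine σ.run_cell _ 1 a.compile e (by omega) rfl rfl (by simp [Store.high, ha]) ?_
    intro q i hne hi
    match i, hi with
    | 0, _ => rfl
    | 1, _ => exact Function.update_of_ne (by omega) _ _
    | 2, _ => rfl
    | 3, _ => rfl
    | 4, _ => rfl
  | setMark a e =>
    intro σ Q h
    refine ⟨_, _, ?_, h⟩
    have ha := AExpr.eval_compile σ a
    rw [← AExpr.cost_compile a]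
    refine σ.run_cell _ 2 a.compile e (by omega) rfl rfl (by simp [Store.high, ha]) ?_
    intro q i hne hi
    match i, hi with
    | 0, _ => rfl
    | 1, _ => rfl
    | 2, _ => exact Function.update_of_ne (by omega) _ _
    | 3, _ => rfl
    | 4, _ => rfl
  | setPar a e =>
    intro σ Q h
    refine ⟨_, _, ?_, h⟩
    have ha := AExpr.eval_compile σ a
    rw [← AExpr.cost_compile a]
    refine σ.run_cell _ 3 a.compile e (by omega) rfl rfl (by simp [Store.high, ha]) ?_
    intro q i hne hi
    match i, hi with
    | 0, _ => rfl
    | 1, _ => rfl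
    | 2, _ => rfl
    | 3, _ => exact Function.update_of_ne (by omega) _ _
    | 4, _ => rfl
  | setNbr v c e =>
    intro σ Q h
    refine ⟨_, _, ?_, h⟩
    have := Run.store σ.state (cellExpr 4 (tableExpr v.compile c.compile)) e.compile
    rw [AExpr.eval_compile, show (cellExpr 4 (tableExpr v.compile c.compile)).eval σ.state =
      3 * σ.r 1 + (5 * tableIndex (v.eval σ) (c.eval σ) + 4) by
      simp only [cellExpr, tableExpr, tableIndex, Expr.eval, Op.eval, AExpr.eval_compile]; rfl,
      σ.update_nbr, show (cellExpr 4 (tableExpr v.compile c.compile)).cost + e.compile.cost + 1 =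
      3 * v.cost + 2 * c.cost + e.cost + 13 by
      simp only [cellExpr, tableExpr, Expr.cost, AExpr.cost_compile]; omega] at this
    exact this
  | seq p q ihp ihq =>
    intro σ Q h
    obtain ⟨σ₁, t₁, h₁, hq⟩ := ihp _ _ h
    obtain ⟨σ₂, t₂, h₂, hQ⟩ := ihq _ _ hq
    exact ⟨σ₂, _, .seq h₁ h₂, hQ⟩
  | ite e p q ihp ihq =>
    intro σ Q h
    by_cases he : e.eval σ = 0
    · obtain ⟨σ₁, t₁, h₁, hq⟩ := ihq _ _ (h.2 he)
      exact ⟨σ₁, _, .ite_false (by rwa [AExpr.eval_compile]) h₁, by rwa [AExpr.cost_compile]⟩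
    · obtain ⟨σ₁, t₁, h₁, hq⟩ := ihp _ _ (h.1 he)
      exact ⟨σ₁, _, .ite_true (by rwa [AExpr.eval_compile]) h₁, by rwa [AExpr.cost_compile]⟩
  | loop e p _ => exact fun σ Q h => h

theorem Cmd.Runs.mono {p : Cmd} {σ : Store} {Q Q' : Store → ℕ → Prop} (h : p.Runs σ Q)
    (hQ : ∀ σ' t, Q σ' t → Q' σ' t) : p.Runs σ Q' := by
  obtain ⟨σ', t, h, hq⟩ := h
  exact ⟨σ', t, h, hQ _ _ hq⟩

/-- Total correctness of a loop: the invariant `I i σ t` has an index `i` that decreases in each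
round, and `t` is the time spent so far. -/
theorem Cmd.runs_loop {e : AExpr} {p : Cmd} (I : ℕ → Store → ℕ → Prop)
    (hI : ∀ i σ t, I i σ t → e.eval σ ≠ 0 → ∀ P : Store → ℕ → Prop,
      (∀ σ' t' i', i' < i → I i' σ' (t + (e.cost + 1 + t')) → P σ' t') → p.vc σ P)
    {i : ℕ} {σ : Store} (h : I i σ 0) :
    (loop e p).Runs σ fun σ' t => ∃ i' t', I i' σ' t' ∧ e.eval σ' = 0 ∧ t = t' + (e.cost + 1) := by
  suffices H : ∀ i σ t₀, I i σ t₀ → (loop e p).Runs σ fun σ' t =>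
      ∃ i' t', I i' σ' t' ∧ e.eval σ' = 0 ∧ t₀ + t = t' + (e.cost + 1) by
    simpa using H i σ 0 h
  intro i
  induction i using Nat.strong_induction_on with
  | _ i ih =>
    intro σ t₀ h
    by_cases he : e.eval σ = 0
    · exact ⟨σ, _, .loop_false (by rwa [AExpr.eval_compile]), i, t₀, h, he, by
        rw [AExpr.cost_compile]⟩
    · obtain ⟨σ₁, t₁, h₁, i', hi', hI'⟩ := Cmd.runs_of_vc _ _ _ (hI i σ t₀ h he
        (fun σ' t' => ∃ i' < i, I i' σ' (t₀ + (e.cost + 1 + t'))) fun σ' t' i' h₁ h₂ => ⟨i', h₁, h₂⟩)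
      obtain ⟨σ₂, t₂, h₂, i₂, t', hI₂, he₂, ht⟩ := ih i' hi' σ₁ _ hI'
      refine ⟨σ₂, _, .loop_true (by rwa [AExpr.eval_compile]) h₁ h₂, i₂, t', hI₂, he₂, ?_⟩
      rw [AExpr.cost_compile, ← ht]
      ring

end WordRAM

/-! ### Partial colourings, holes and the potential -/

open WordRAM

namespace EdgeColouring

/-- A graph on the vertices `0, …, n - 1` together with upper bounds `d` for its degrees. -/
structure Host where
  n : ℕ
  Adj : ℕ → ℕ → Prop
  d : ℕ → ℕ
  symm : ∀ {u v}, Adj u v → Adj v u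
  irrefl : ∀ v, ¬ Adj v v
  lt : ∀ {u v}, Adj u v → u < n
  card_le : ∀ (v : ℕ) (s : Finset ℕ), (∀ u ∈ s, Adj v u) → s.card ≤ d v
  d_le : ∀ v, d v ≤ n

variable {g : Host} {f : ℕ → ℕ → ℕ}

/-- A partial proper edge colouring, given by a table: `f v c = w + 1` says that the edge `vw` has
the colour `c`, and `f v c = 0` that the colour `c` is missing at `v`. The colour of an edge `vw`
is at most `max (d v) (d w)`. -/
structure PartialColouring (g : Host) (f : ℕ → ℕ → ℕ) : Prop where
  adj : ∀ {v c w}, f v c = w + 1 → g.Adj v w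
  symm : ∀ {v c w}, f v c = w + 1 → f w c = v + 1
  le : ∀ {v c w}, f v c = w + 1 → c ≤ max (g.d v) (g.d w)
  inj : ∀ {v c c' w}, f v c = w + 1 → f v c' = w + 1 → c = c'

/-- An edge without colour. -/
def Hole (g : Host) (f : ℕ → ℕ → ℕ) (x y : ℕ) : Prop :=
  g.Adj x y ∧ ∀ c, f x c ≠ y + 1

/-- Give the colour `c` to the edge `uv`. -/
def link (f : ℕ → ℕ → ℕ) (u v c : ℕ) : ℕ → ℕ → ℕ :=
  setEntry (setEntry f u c (v + 1)) v c (u + 1)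

/-- Remove the colour `c` of the edge `uv`. -/
def unlink (f : ℕ → ℕ → ℕ) (u v c : ℕ) : ℕ → ℕ → ℕ :=
  setEntry (setEntry f u c 0) v c 0

/-- Move the colour `c` from the edge `xw` to the edge `xy`. -/
def moveColour (f : ℕ → ℕ → ℕ) (x y w c : ℕ) : ℕ → ℕ → ℕ :=
  link (unlink f x w c) x y c

/-- The coloured edges. -/
def coloured (f : ℕ → ℕ → ℕ) : Set (Sym2 ℕ) := {e | ∃ u v c, f u c = v + 1 ∧ e = s(u, v)}

/-- Whether the colour `c` is small for the vertex `v`. -/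
def small (g : Host) (v c : ℕ) : ℕ := if c ≤ g.d v then 1 else 0

/-- The number of pairs of a vertex and a colour that is present and small at the vertex. -/
def potential (g : Host) (f : ℕ → ℕ → ℕ) : ℕ :=
  ∑ v ∈ Finset.range g.n, ∑ c ∈ Finset.range (g.d v + 1), if f v c = 0 then 0 else 1

theorem small_le_one (v c : ℕ) : small g v c ≤ 1 := by
  unfold small; split_ifs <;> omega

theorem small_eq_one {v c : ℕ} (h : c ≤ g.d v) : small g v c = 1 := if_pos h

theorem small_eq_zero {v c : ℕ} (h : g.d v < c) : small g v c = 0 := if_neg (by omega)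

theorem Host.ne (g : Host) {u v : ℕ} (h : g.Adj u v) : u ≠ v := by
  rintro rfl; exact g.irrefl _ h

theorem Hole.symm (hf : PartialColouring g f) {x y : ℕ} (h : Hole g f x y) : Hole g f y x :=
  ⟨g.symm h.1, fun c hc => h.2 c (hf.symm hc)⟩

/-- No edge gets two colours because a hole has none, seen from either end. -/
theorem PartialColouring.link (hf : PartialColouring g f) {u v c : ℕ} (h : Hole g f u v)
    (hu : f u c = 0) (hv : f v c = 0) (hc : c ≤ max (g.d u) (g.d v)) :
    PartialColouring g (link f u v c) := by
  have h' := h.symm hf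
  have hne := g.ne h.1
  obtain ⟨h1, h2⟩ := h
  obtain ⟨h1', h2'⟩ := h'
  have e : ∀ p q, EdgeColouring.link f u v c p q =
    if p = v ∧ q = c then u + 1 else if p = u ∧ q = c then v + 1 else f p q := fun _ _ => rfl
  constructor
  · intro p q w hp
    rw [e] at hp
    split_ifs at hp with h3 h4
    · obtain ⟨rfl, rfl⟩ := h3; obtain rfl : u = w := by omega
      exact h1'
    · obtain ⟨rfl, rfl⟩ := h4; obtain rfl : v = w := by omega
      exact h1
    · exact hf.adj hp
  · intro p q w hp
    rw [e] at hp ⊢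
    split_ifs at hp with h3 h4
    · obtain ⟨rfl, rfl⟩ := h3; obtain rfl : u = w := by omega
      simp [hne]
    · obtain ⟨rfl, rfl⟩ := h4; obtain rfl : v = w := by omega
      simp
    · have := hf.symm hp
      rw [if_neg, if_neg]
      · exact this
      · rintro ⟨rfl, rfl⟩; omega
      · rintro ⟨rfl, rfl⟩; omega
  · intro p q w hp
    rw [e] at hp
    split_ifs at hp with h3 h4
    · obtain ⟨rfl, rfl⟩ := h3; obtain rfl : u = w := by omega
      rwa [max_comm]
    · obtain ⟨rfl, rfl⟩ := h4; obtain rfl : v = w := by omega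
      exact hc
    · exact hf.le hp
  · intro p q q' w hp hp'
    rw [e] at hp hp'
    have := h2 q
    have := h2 q'
    have := h2' q
    have := h2' q'
    split_ifs at hp hp' with h3 h4 h5 h6 h7 h8
    all_goals first
      | omega
      | exact hf.inj hp hp'
      | grind

theorem PartialColouring.unlink (hf : PartialColouring g f) {u v c : ℕ} (h : f u c = v + 1) :
    PartialColouring g (unlink f u v c) := by
  have h' := hf.symm h
  have e : ∀ p q, EdgeColouring.unlink f u v c p q =
    if p = v ∧ q = c then 0 else if p = u ∧ q = c then 0 else f p q := fun _ _ => rfl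
  have key : ∀ {p q w}, EdgeColouring.unlink f u v c p q = w + 1 → f p q = w + 1 := by
    intro p q w hp
    rw [e] at hp
    split_ifs at hp
    exact hp
  refine ⟨fun hp => hf.adj (key hp), ?_, fun hp => hf.le (key hp),
    fun hp hp' => hf.inj (key hp) (key hp')⟩
  intro p q w hp
  have h1 := hf.symm (key hp)
  rw [e] at hp ⊢
  grind

/-- Only the summand at `(v, c)` can change, and it is present only if `c` is small at `v`. The
additive form avoids truncated subtraction. -/
theorem potential_setEntry (f : ℕ → ℕ → ℕ) {v : ℕ} (hv : v < g.n) (c w : ℕ) :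
    potential g (setEntry f v c w) + (if f v c = 0 then 0 else small g v c) =
      potential g f + (if w = 0 then 0 else small g v c) := by
  unfold potential
  rw [← Finset.add_sum_erase _ _ (Finset.mem_range.2 hv),
    ← Finset.add_sum_erase (Finset.range g.n) _ (Finset.mem_range.2 hv)]
  have h1 : ∑ v' ∈ (Finset.range g.n).erase v, (∑ c' ∈ Finset.range (g.d v' + 1),
      if setEntry f v c w v' c' = 0 then 0 else 1) =
      ∑ v' ∈ (Finset.range g.n).erase v, (∑ c' ∈ Finset.range (g.d v' + 1),
      if f v' c' = 0 then 0 else 1) := by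
    refine Finset.sum_congr rfl fun v' hv' => Finset.sum_congr rfl fun c' _ => ?_
    simp [setEntry, Finset.ne_of_mem_erase hv']
  rw [h1]
  by_cases hc : c ≤ g.d v
  · have hm : c ∈ Finset.range (g.d v + 1) := Finset.mem_range.2 (by omega)
    rw [← Finset.add_sum_erase _ _ hm, ← Finset.add_sum_erase (Finset.range (g.d v + 1)) _ hm]
    have h2 : ∑ c' ∈ (Finset.range (g.d v + 1)).erase c,
        (if setEntry f v c w v c' = 0 then 0 else 1) =
        ∑ c' ∈ (Finset.range (g.d v + 1)).erase c, if f v c' = 0 then 0 else 1 := by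
      refine Finset.sum_congr rfl fun c' hc' => ?_
      simp [setEntry, Finset.ne_of_mem_erase hc']
    rw [h2, small_eq_one hc]
    simp only [setEntry, and_self, if_true]
    omega
  · have h2 : ∑ c' ∈ Finset.range (g.d v + 1), (if setEntry f v c w v c' = 0 then 0 else 1) =
        ∑ c' ∈ Finset.range (g.d v + 1), if f v c' = 0 then 0 else 1 := by
      refine Finset.sum_congr rfl fun c' hc' => ?_
      have : c' ≠ c := by rw [Finset.mem_range] at hc'; omega
      simp [setEntry, this]
    rw [h2, small_eq_zero (by omega)]
    simp

theorem potential_link {u v c : ℕ} (h : g.Adj u v) (hu : f u c = 0) (hv : f v c = 0) :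
    potential g (link f u v c) = potential g f + small g u c + small g v c := by
  have h1 := potential_setEntry f (g.lt h) c (v + 1)
  have h2 := potential_setEntry (setEntry f u c (v + 1)) (g.lt (g.symm h)) c (u + 1)
  have h3 : setEntry f u c (v + 1) v c = 0 := by simp [setEntry, (g.ne h).symm, hv]
  simp only [h3, hu, if_true, Nat.succ_ne_zero, if_false] at h1 h2
  unfold link
  omega

theorem potential_unlink (hf : PartialColouring g f) {u v c : ℕ} (h : f u c = v + 1) :
    potential g (unlink f u v c) + small g u c + small g v c = potential g f := by
  have ha := hf.adj h
  have h1 := potential_setEntry f (g.lt ha) c 0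
  have h2 := potential_setEntry (setEntry f u c 0) (g.lt (g.symm ha)) c 0
  have h3 : setEntry f u c 0 v c = u + 1 := by simp [setEntry, (g.ne ha).symm, hf.symm h]
  simp only [h3, h, if_true, Nat.succ_ne_zero, if_false] at h1 h2
  unfold unlink
  omega

theorem coloured_link {u v c : ℕ} (huv : u ≠ v) (hu : f u c = 0) (hv : f v c = 0) :
    insert s(u, v) (coloured f) ⊆ coloured (link f u v c) := by
  rintro e (rfl | ⟨p, q, c', h, rfl⟩)
  · exact ⟨u, v, c, by simp [link, setEntry, huv], rfl⟩
  · refine ⟨p, q, c', ?_, rfl⟩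
    simp only [link, setEntry]
    rw [if_neg, if_neg, h]
    · rintro ⟨rfl, rfl⟩; omega
    · rintro ⟨rfl, rfl⟩; omega

theorem coloured_unlink (hf : PartialColouring g f) {u v c : ℕ} (h : f u c = v + 1) :
    coloured f ⊆ insert s(u, v) (coloured (unlink f u v c)) := by
  rintro e ⟨p, q, c', hp, rfl⟩
  have h' := hf.symm h
  by_cases h1 : p = v ∧ c' = c
  · obtain ⟨rfl, rfl⟩ := h1
    left
    rw [show q = u by omega, Sym2.eq_swap]
  by_cases h2 : p = u ∧ c' = c
  · obtain ⟨rfl, rfl⟩ := h2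
    left
    rw [show q = v by omega]
  · right
    exact ⟨p, q, c', by simp only [unlink, setEntry]; rw [if_neg h1, if_neg h2, hp], rfl⟩

theorem unlink_apply (f : ℕ → ℕ → ℕ) (u v c p q : ℕ) :
    unlink f u v c p q = if q = c ∧ (p = u ∨ p = v) then 0 else f p q := by
  simp only [unlink, setEntry]; grind

theorem link_apply (f : ℕ → ℕ → ℕ) (u v c p q : ℕ) :
    link f u v c p q = if q = c then (if p = v then u + 1 else if p = u then v + 1 else f p q)
      else f p q := by
  simp only [link, setEntry]; grind

theorem moveColour_apply (f : ℕ → ℕ → ℕ) (x y w c p q : ℕ) :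
    moveColour f x y w c p q = if q = c then (if p = y then x + 1 else if p = x then y + 1
      else if p = w then 0 else f p q) else f p q := by
  simp only [moveColour, link, unlink, setEntry]; grind

/-- The colour of the edge `xw` is moved to the hole `xy`. -/
structure Moved (g : Host) (f : ℕ → ℕ → ℕ) (x y w c : ℕ) : Prop where
  colouring : PartialColouring g (moveColour f x y w c)
  hole : Hole g (moveColour f x y w c) x w
  potential : potential g (moveColour f x y w c) + small g w c = potential g f + small g y c
  coloured : insert s(x, y) (coloured f) ⊆
    insert s(x, w) (coloured (moveColour f x y w c))
  ne : w ≠ y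

/-- At `x` the colour `c` only changes its edge, so the potential sees just its loss at `w` and its
gain at `y`. If `c` is small at `y`, the potential therefore does not drop, and it rises precisely
when `c` is not small at `w`. -/
theorem moved (hf : PartialColouring g f) {x y w c : ℕ} (h : Hole g f x y) (hy : f y c = 0)
    (hx : f x c = w + 1) (hc : c ≤ max (g.d x) (g.d y)) : Moved g f x y w c := by
  have hwy : w ≠ y := by rintro rfl; exact h.2 _ hx
  have hxy := g.ne h.1
  have hu := hf.unlink hx
  have h1 : unlink f x w c x c = 0 := by simp [unlink_apply]
  have h2 : unlink f x w c y c = 0 := by simp [unlink_apply, hy]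
  have hh : Hole g (unlink f x w c) x y := by
    refine ⟨h.1, fun c' => ?_⟩
    have := h.2 c'
    rw [unlink_apply]
    split_ifs <;> omega
  refine ⟨hu.link hh h1 h2 hc, ⟨hf.adj hx, fun c' hc' => ?_⟩, ?_, ?_, hwy⟩
  · rw [moveColour_apply] at hc'
    split_ifs at hc' with h3 h4
    · omega
    · omega
    · exact h3 (hf.inj hc' hx)
  · have e1 := potential_unlink hf hx
    have e2 := potential_link h.1 h1 h2
    unfold moveColour
    omega
  · have e1 := coloured_unlink hf hx
    have e2 := coloured_link hxy h1 h2
    rintro e (rfl | he)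
    · exact Or.inr (e2 (Or.inl rfl))
    · rcases e1 he with he | he
      · exact Or.inl he
      · exact Or.inr (e2 (Or.inr he))

/-- If the first `k` colours are present at a vertex, then its degree is at least `k`. -/
theorem PartialColouring.le_degree (hf : PartialColouring g f) {v : ℕ} (s : Finset ℕ)
    (h : ∀ c ∈ s, f v c ≠ 0) : s.card ≤ g.d v := by
  have h1 : (s.image fun c => f v c - 1).card = s.card := by
    refine Finset.card_image_of_injOn fun c hc c' hc' he => ?_
    have := h c hc
    have := h c' hc'
    exact hf.inj (v := v) (w := f v c - 1) (by omega) (by omega)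
  rw [← h1]
  refine g.card_le v _ fun u hu => ?_
  obtain ⟨c, hc, rfl⟩ := Finset.mem_image.1 hu
  have := h c hc
  exact hf.adj (c := c) (by omega)

/-- The colours present at a vertex belong to different edges, so each vertex contributes at most
its degree. -/
theorem PartialColouring.potential_le (hf : PartialColouring g f) :
    potential g f ≤ ∑ v ∈ Finset.range g.n, g.d v := by
  refine Finset.sum_le_sum fun v _ => ?_
  have : ∑ c ∈ Finset.range (g.d v + 1), (if f v c = 0 then 0 else 1) =
      ((Finset.range (g.d v + 1)).filter fun c => f v c ≠ 0).card := by
    rw [Finset.card_filter]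
    exact Finset.sum_congr rfl fun c _ => by simp
  rw [this]
  exact hf.le_degree _ fun c hc => (Finset.mem_filter.1 hc).2

-- The program

infixr:60 " ;; " => Cmd.seq

/-- Recompute the missing colour of the vertex in register `i`. -/
def rescan (i : ℕ) : Cmd :=
  .setMiss (.reg i) (.const 0) ;;
  .loop (.nbr (.reg i) (.miss (.reg i)))
    (.setMiss (.reg i) (.op .add (.miss (.reg i)) (.const 1)))

/-- Give the colour in register `c` to the edge between the vertices in registers `u` and `v`. -/
def linkCmd (u v c : ℕ) : Cmd :=
  .setNbr (.reg u) (.reg c) (.op .add (.reg v) (.const 1)) ;;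
  .setNbr (.reg v) (.reg c) (.op .add (.reg u) (.const 1))

/-- Remove the colour in register `c` from the edge between the vertices in registers `u`, `v`. -/
def unlinkCmd (u v c : ℕ) : Cmd :=
  .setNbr (.reg u) (.reg c) (.const 0) ;; .setNbr (.reg v) (.reg c) (.const 0)

/-- Build the fan of the hole `xy`, where `x` and `y` are in registers `3` and `4`. The last
vertex of the fan is put into register `6`, and the vertex to which the hole is to be shifted into
register `8`. -/
def explore : Cmd :=
  .set 6 (.reg 4) ;; .set 15 (.const 1) ;;
  .loop (.reg 15)
    (.set 10 (.miss (.reg 6)) ;; .set 7 (.nbr (.reg 3) (.reg 10)) ;;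
     .ite (.reg 7)
      (.set 7 (.op .sub (.reg 7) (.const 1)) ;;
       .ite (.op .eq (.mark (.reg 7)) (.reg 16))
        (.set 8 (.par (.reg 7)) ;; .set 15 (.const 0))
        (.setMark (.reg 7) (.reg 16) ;; .setPar (.reg 7) (.reg 6) ;; .set 6 (.reg 7)))
      (.set 8 (.reg 6) ;; .set 15 (.const 0)))

/-- Shift the hole `xy` along its fan until `y` is the vertex in register `8`. Register `9` holds
`0` or the successor of a colour that `y` has just lost. -/
def shift : Cmd :=
  .loop (.op .eq (.op .eq (.reg 4) (.reg 8)) (.const 0))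
    (.set 10 (.miss (.reg 4)) ;;
     .set 7 (.op .sub (.nbr (.reg 3) (.reg 10)) (.const 1)) ;;
     unlinkCmd 3 7 10 ;; linkCmd 3 4 10 ;;
     .ite (.op .mul (.op .lt (.const 0) (.reg 9))
        (.op .lt (.reg 9) (.op .add (.deg (.reg 4)) (.const 2))))
      (.setMiss (.reg 4) (.op .sub (.reg 9) (.const 1)))
      (rescan 4) ;;
     .set 9 (.op .add (.reg 10) (.const 1)) ;;
     .set 4 (.reg 7))

/-- Move the hole `uv`, where `u` and `v` are in registers `11` and `12`, along the alternating
path with the colours in registers `13` and `14`, until its end is reached and the hole is closed,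
or the next edge of the path cannot be recoloured. -/
def walk : Cmd :=
  .loop (.reg 15)
    (.set 7 (.nbr (.reg 12) (.reg 13)) ;;
     .ite (.reg 7)
      (.set 7 (.op .sub (.reg 7) (.const 1)) ;;
       .ite (.op .mul (.op .lt (.deg (.reg 12)) (.reg 14)) (.op .lt (.deg (.reg 7)) (.reg 14)))
        (.set 15 (.const 0))
        (unlinkCmd 12 7 13 ;; linkCmd 12 11 13 ;;
         .set 11 (.reg 12) ;; .set 12 (.reg 7) ;;
         .set 17 (.reg 13) ;; .set 13 (.reg 14) ;; .set 14 (.reg 17)))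
      (linkCmd 11 12 13 ;; .set 5 (.const 0) ;; .set 15 (.const 0)))

/-- If the alternating path has ended at the vertex in register `8`, shift the hole to the end of
the fan. -/
def turn : Cmd :=
  .ite (.nbr (.reg 8) (.reg 18))
    (.set 10 (.miss (.reg 3)) ;;
     .set 7 (.op .sub (.nbr (.reg 3) (.reg 10)) (.const 1)) ;;
     unlinkCmd 3 7 10 ;; linkCmd 3 8 10 ;; rescan 8 ;;
     .set 8 (.reg 6) ;; .set 4 (.reg 7) ;; .set 9 (.op .add (.reg 10) (.const 1)) ;; shift)
    .skip

/-- Close the hole between the vertices in registers `3` and `8` with the colour in register `10`,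
and update the missing colours. -/
def finish : Cmd :=
  linkCmd 3 8 10 ;; rescan 3 ;; rescan 11 ;; rescan 12 ;; rescan 8 ;;
  .set 3 (.reg 11) ;; .set 4 (.reg 12)

/-- One step of the algorithm: the hole in registers `3` and `4` is closed, in which case register
`5` becomes `0`, or replaced with another one. -/
def step : Cmd :=
  .set 16 (.op .add (.reg 16) (.const 1)) ;; explore ;; .set 9 (.const 0) ;; shift ;;
  .set 10 (.miss (.reg 8)) ;; .set 7 (.nbr (.reg 3) (.reg 10)) ;;
  .set 11 (.reg 3) ;; .set 12 (.reg 3) ;;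
  .ite (.reg 7)
    (.set 7 (.op .sub (.reg 7) (.const 1)) ;; unlinkCmd 3 7 10 ;; .set 12 (.reg 7) ;;
     .set 13 (.miss (.reg 3)) ;; .set 14 (.reg 10) ;; .set 15 (.const 1) ;; .set 18 (.reg 10) ;;
     walk ;; turn ;; .set 10 (.reg 18))
    (.set 5 (.const 0)) ;;
  finish

/-- Compute the degrees. -/
def countDegrees : Cmd :=
  .set 2 (.const 0) ;;
  .loop (.op .lt (.reg 2) (.reg 1))
    (.set 3 (.low (.op .add (.reg 2) (.reg 2))) ;;
     .set 4 (.low (.op .add (.op .add (.reg 2) (.reg 2)) (.const 1))) ;;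
     .setDeg (.reg 3) (.op .add (.deg (.reg 3)) (.const 1)) ;;
     .setDeg (.reg 4) (.op .add (.deg (.reg 4)) (.const 1)) ;;
     .set 2 (.op .add (.reg 2) (.const 1)))

/-- Colour the edges one after the other. -/
def colourEdges : Cmd :=
  .set 2 (.const 0) ;;
  .loop (.op .lt (.reg 2) (.reg 1))
    (.set 3 (.low (.op .add (.reg 2) (.reg 2))) ;;
     .set 4 (.low (.op .add (.op .add (.reg 2) (.reg 2)) (.const 1))) ;;
     .set 5 (.const 1) ;; .loop (.reg 5) step ;;
     .set 2 (.op .add (.reg 2) (.const 1)))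

/-- Write the colours of the edges behind the input. -/
def writeColours : Cmd :=
  .set 2 (.const 0) ;;
  .loop (.op .lt (.reg 2) (.reg 1))
    (.set 3 (.low (.op .add (.reg 2) (.reg 2))) ;;
     .set 4 (.low (.op .add (.op .add (.reg 2) (.reg 2)) (.const 1))) ;;
     .set 10 (.const 0) ;;
     .loop (.op .eq (.op .eq (.nbr (.reg 3) (.reg 10)) (.op .add (.reg 4) (.const 1))) (.const 0))
      (.set 10 (.op .add (.reg 10) (.const 1))) ;;
     .setLow (.op .add (.op .add (.reg 1) (.reg 1)) (.reg 2)) (.op .add (.reg 10) (.const 1)) ;;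
     .set 2 (.op .add (.reg 2) (.const 1)))

/-- The edge colouring algorithm. -/
def edgeColour : Cmd := countDegrees ;; colourEdges ;; writeColours

theorem edgeColour_tame : edgeColour.compile.Tame 40 = true := by decide +kernel

/-! ### Missing colours and fans -/

theorem rescan_vc {σ : Store} (hf : PartialColouring g σ.nbr) (i : ℕ) {Q : Store → ℕ → Prop}
    (hQ : ∀ c t, σ.nbr (σ.r i) c = 0 → c ≤ g.d (σ.r i) → t ≤ 100 * (g.n + 1) →
      Q { σ with miss := Function.update σ.miss (σ.r i) c } t) :
    (rescan i).vc σ Q := by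
  simp only [rescan, Cmd.vc, AExpr.eval, AExpr.cost]
  -- The search stops by `d(v)`: otherwise the `d(v) + 1` small colours would all be present. One
  -- round costs 37 units for the test and 22 for the update.
  refine (Cmd.runs_loop (fun k τ t => ∃ c, k + c = g.d (σ.r i) ∧ t = 59 * c ∧
    τ = { σ with miss := Function.update σ.miss (σ.r i) c } ∧ ∀ c' < c, σ.nbr (σ.r i) c' ≠ 0)
    ?_ ⟨0, by rfl, by omega, rfl, by omega⟩).mono ?_
  · rintro k _ t ⟨c, hk, rfl, rfl, hc⟩ he P hP
    simp only [Cmd.vc, AExpr.eval, AExpr.cost, Op.eval, Function.update_self] at he ⊢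
    have hc' : ∀ c' ∈ Finset.range (c + 1), σ.nbr (σ.r i) c' ≠ 0 := by
      intro c' h
      rcases Nat.lt_succ_iff_lt_or_eq.1 (Finset.mem_range.1 h) with h | rfl
      · exact hc _ h
      · exact he
    have := hf.le_degree _ hc'
    rw [Finset.card_range] at this
    exact hP _ _ (k - 1) (by omega) ⟨c + 1, by omega, by simp only [AExpr.cost]; omega, by simp,
      fun c' h => hc' c' (Finset.mem_range.2 h)⟩
  · rintro _ _ ⟨k, t, ⟨c, hk, rfl, rfl, hc⟩, he, rfl⟩
    simp only [AExpr.eval, AExpr.cost, Function.update_self] at he ⊢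
    have := g.d_le (σ.r i)
    exact hQ c _ he (by omega) (by omega)

/-- The vertices `Y a, …, Y k` form a fan at `x`: the missing colour of `Y i` is the colour of the
edge from `x` to `Y (i + 1)`. -/
structure Fan (f : ℕ → ℕ → ℕ) (miss : ℕ → ℕ) (x : ℕ) (Y : ℕ → ℕ) (a k : ℕ) : Prop where
  step : ∀ i, a ≤ i → i < k → f x (miss (Y i)) = Y (i + 1) + 1
  inj : ∀ i j, a ≤ i → i ≤ k → a ≤ j → j ≤ k → Y i = Y j → i = j

theorem Fan.adj {f : ℕ → ℕ → ℕ} {miss : ℕ → ℕ} {x : ℕ} {Y : ℕ → ℕ} {a k : ℕ}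
    (h : Fan f miss x Y a k) (hf : PartialColouring g f) (ha : g.Adj x (Y a)) :
    ∀ i, a ≤ i → i ≤ k → g.Adj x (Y i) := by
  intro i hi hk
  rcases Nat.eq_or_lt_of_le hi with rfl | hi
  · exact ha
  · have := h.step (i - 1) (by omega) (by omega)
    rw [show i - 1 + 1 = i by omega] at this
    exact hf.adj this

/-- The vertices of a fan are distinct vertices of the host. -/
theorem Fan.lt {f : ℕ → ℕ → ℕ} {miss : ℕ → ℕ} {x : ℕ} {Y : ℕ → ℕ} {a k : ℕ}
    (h : Fan f miss x Y a k) (hf : PartialColouring g f) (ha : g.Adj x (Y a)) :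
    k + 1 ≤ g.n + a := by
  have h1 : ((Finset.Icc a k).image Y).card = (Finset.Icc a k).card :=
    Finset.card_image_of_injOn fun i hi j hj e => by
      simp only [Finset.coe_Icc, Set.mem_Icc] at hi hj
      exact h.inj i j hi.1 hi.2 hj.1 hj.2 e
  have h2 : (Finset.Icc a k).image Y ⊆ Finset.range g.n := by
    intro v hv
    obtain ⟨i, hi, rfl⟩ := Finset.mem_image.1 hv
    rw [Finset.mem_Icc] at hi
    exact Finset.mem_range.2 (g.lt (g.symm (h.adj hf ha i hi.1 hi.2)))
  have h3 := Finset.card_le_card h2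
  rw [h1, Nat.card_Icc, Finset.card_range] at h3
  omega

/-- The outcome of `explore`. -/
structure Explored (σ τ : Store) (Y : ℕ → ℕ) (k s : ℕ) : Prop where
  low : τ.low = σ.low
  deg : τ.deg = σ.deg
  miss : τ.miss = σ.miss
  nbr : τ.nbr = σ.nbr
  reg : ∀ i, i ≠ 6 → i ≠ 7 → i ≠ 8 → i ≠ 10 → i ≠ 15 → τ.r i = σ.r i
  mark : ∀ v, τ.mark v ≤ σ.r 16
  zero : Y 0 = σ.r 4
  le : s ≤ k
  target : τ.r 8 = Y s
  last : τ.r 6 = Y k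
  fan : Fan σ.nbr σ.miss (σ.r 3) Y 0 k
  exit : (s = k ∧ σ.nbr (σ.r 3) (σ.miss (Y k)) = 0) ∨ (s < k ∧ σ.miss (Y s) = σ.miss (Y k))

theorem explore_vc {σ : Store} (hf : PartialColouring g σ.nbr)
    (hh : Hole g σ.nbr (σ.r 3) (σ.r 4)) (hm : ∀ v, σ.mark v < σ.r 16) {Q : Store → ℕ → Prop}
    (hQ : ∀ τ t Y k s, Explored σ τ Y k s → t ≤ 300 * (g.n + 1) → Q τ t) :
    explore.vc σ Q := by
  simp only [explore, Cmd.vc, AExpr.eval, AExpr.cost]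
  refine ⟨by decide, by decide, ?_⟩
  -- The iteration is total thanks to truncated subtraction; its values matter only as far as they
  -- form a fan.
  set Y : ℕ → ℕ := fun i => (fun z => σ.nbr (σ.r 3) (σ.miss z) - 1)^[i] (σ.r 4) with hY
  have hY0 : Y 0 = σ.r 4 := rfl
  have hYs : ∀ i, Y (i + 1) = σ.nbr (σ.r 3) (σ.miss (Y i)) - 1 := fun i => by
    simp only [hY, Function.iterate_succ_apply']
  have hlt : ∀ {k}, Fan σ.nbr σ.miss (σ.r 3) Y 0 k → k + 1 ≤ g.n :=
    fun h => h.lt hf hh.1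
  refine (Cmd.runs_loop (fun idx τ t => ∃ k, τ.low = σ.low ∧ τ.deg = σ.deg ∧ τ.miss = σ.miss ∧
    τ.nbr = σ.nbr ∧ (∀ i, i ≠ 6 → i ≠ 7 → i ≠ 8 → i ≠ 10 → i ≠ 15 → τ.r i = σ.r i) ∧
    (∀ v, τ.mark v ≤ σ.r 16) ∧ τ.r 6 = Y k ∧ Fan σ.nbr σ.miss (σ.r 3) Y 0 k ∧
    ((τ.r 15 = 1 ∧ idx + k = g.n + 1 ∧ t ≤ 150 * k ∧
      (∀ v, τ.mark v = σ.r 16 ↔ ∃ i < k, v = Y (i + 1)) ∧ ∀ i < k, τ.par (Y (i + 1)) = Y i) ∨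
     (τ.r 15 = 0 ∧ idx = 0 ∧ t ≤ 150 * (k + 1) ∧ ∃ s, Explored σ τ Y k s)))
    ?_ (i := g.n + 1) ?_).mono ?_
  · rintro idx τ t ⟨k, h1, h2, h3, h4, h5, h6, h7, h8, h⟩ he P hP
    simp only [AExpr.eval, AExpr.cost] at he hP
    obtain ⟨h9, h10, h11, h12, h13⟩ | ⟨h9, -⟩ := h
    swap
    · exact absurd h9 he
    have hk := hlt h8
    simp only [Cmd.vc, AExpr.eval, AExpr.cost, Op.eval, Function.update_apply, ne_eq,
      OfNat.ofNat_ne_one, not_false_eq_true, true_and, h3, h4, h7,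
      Nat.reduceEqDiff, if_true, if_false, h5 3 (by decide) (by decide) (by decide) (by decide)
      (by decide), h5 16 (by decide) (by decide) (by decide) (by decide) (by decide)]
    refine ⟨fun hw => ⟨fun hmk => ?_, fun hmk => ?_⟩, fun hw => ?_⟩
    · rw [← hYs] at hmk ⊢
      have hmk' : τ.mark (Y (k + 1)) = σ.r 16 := by
        by_contra hc
        simp [hc] at hmk
      obtain ⟨i, hi, hi'⟩ := (h12 _).1 hmk'
      have hpar := h13 i hi
      rw [← hi'] at hpar
      refine hP _ _ 0 (by omega) ⟨k, h1, h2, rfl, rfl, ?_, h6, by simpa using h7, h8, Or.inr ⟨by simp, rfl, by omega, i, ?_⟩⟩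
      · intro j a1 a2 a3 a4 a5
        simp [a2, a3, a4, a5, h5 j a1 a2 a3 a4 a5]
      · refine ⟨h1, h2, rfl, rfl, ?_, h6, hY0, hi.le, by simpa using hpar,
          by simpa using h7, h8, Or.inr ⟨hi, ?_⟩⟩
        · intro j a1 a2 a3 a4 a5
          simp [a2, a3, a4, a5, h5 j a1 a2 a3 a4 a5]
        -- The vertex `Y (k + 1)` is already in the fan as `Y (i + 1)`. The missing colours of `Y i`
        -- and `Y k` are then colours of one and the same edge at `x`, hence equal.
        · have e1 := h8.step i (by omega) hi
          have e2 := hYs k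
          exact hf.inj e1 (by omega)
    · rw [← hYs] at hmk ⊢
      have hmk' : τ.mark (Y (k + 1)) ≠ σ.r 16 := by
        intro hc
        simp [hc] at hmk
      have e2 := hYs k
      have e3 : σ.nbr (σ.r 3) (σ.miss (Y k)) = Y (k + 1) + 1 := by omega
      have hfan : Fan σ.nbr σ.miss (σ.r 3) Y 0 (k + 1) := by
        -- The start `Y 0` carries no mark, but it cannot recur because its edge to `x` is a hole;
        -- later vertices are recognised by their marks.
        have hnew : ∀ i ≤ k, Y i ≠ Y (k + 1) := by
          intro i hi hc
          rcases Nat.eq_zero_or_pos i with rfl | hpos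
          · rw [← hc] at e3
            exact hh.2 _ e3
          · exact hmk' ((h12 _).2 ⟨i - 1, by omega, by
              rw [show i - 1 + 1 = i by omega]; exact hc.symm⟩)
        refine ⟨fun i _ hi => ?_, fun i j _ hi _ hj hij => ?_⟩
        · rcases Nat.lt_succ_iff_lt_or_eq.1 hi with hi | rfl
          · exact h8.step i (by omega) hi
          · exact e3
        · rcases Nat.eq_or_lt_of_le hi with rfl | hi <;> rcases Nat.eq_or_lt_of_le hj with rfl | hj
          · rfl
          · exact absurd hij.symm (hnew j (by omega))
          · exact absurd hij (hnew i (by omega))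
          · exact h8.inj i j (by omega) (by omega) (by omega) (by omega) hij
      refine hP _ _ (idx - 1) (by omega) ⟨k + 1, h1, h2, rfl, rfl, ?_, ?_, by simp, hfan,
        Or.inl ⟨by simpa using h9, by omega, by omega, fun v => ?_, fun i hi => ?_⟩⟩
      · intro j a1 a2 a3 a4 a5
        simp [a1, a2, a4, h5 j a1 a2 a3 a4 a5]
      · intro v
        simp only [Function.update_apply]
        split_ifs
        · exact le_rfl
        · exact h6 v
      · simp only [Function.update_apply]
        split_ifs with hv
        · simp only [true_iff]
          exact ⟨k, by omega, hv⟩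
        · rw [h12]
          constructor
          · rintro ⟨i, hi, hi'⟩
            exact ⟨i, by omega, hi'⟩
          · rintro ⟨i, hi, hi'⟩
            refine ⟨i, ?_, hi'⟩
            rcases Nat.lt_succ_iff_lt_or_eq.1 hi with hi | rfl
            · exact hi
            · exact absurd hi' hv
      · simp only [Function.update_apply]
        split_ifs with hv
        · have := hfan.inj (i + 1) (k + 1) (by omega) (by omega) (by omega) (by omega) hv
          rw [show i = k by omega]
        · rcases Nat.lt_succ_iff_lt_or_eq.1 hi with hi | rfl
          · exact h13 i hi
          · exact absurd rfl hv
    · refine hP _ _ 0 (by omega) ⟨k, h1, h2, rfl, rfl, ?_, h6, by simpa using h7, h8, Or.inr ⟨by simp, rfl, by omega, k, ?_⟩⟩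
      · intro j a1 a2 a3 a4 a5
        simp [a2, a3, a4, a5, h5 j a1 a2 a3 a4 a5]
      · refine ⟨h1, h2, rfl, rfl, ?_, h6, hY0, le_rfl, by simp, by simpa using h7, h8, Or.inl ⟨rfl, hw⟩⟩
        intro j a1 a2 a3 a4 a5
        simp [a2, a3, a4, a5, h5 j a1 a2 a3 a4 a5]
  · refine ⟨0, rfl, rfl, rfl, rfl, ?_, fun v => (hm v).le, by simp [hY0], ⟨by omega, by omega⟩,
      Or.inl ⟨by simp, by omega, by omega, fun v => ?_, by omega⟩⟩
    · intro j a1 a2 a3 a4 a5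
      simp [a1, a5]
    · simp [(hm v).ne]
  · rintro τ _ ⟨idx, t, ⟨k, h1, h2, h3, h4, h5, h6, h7, h8, h⟩, he, rfl⟩
    simp only [AExpr.eval, AExpr.cost] at he ⊢
    obtain ⟨h9, -⟩ | ⟨h9, -, h10, s, h11⟩ := h
    · omega
    have := hlt h8
    exact hQ τ _ Y k s h11 (by omega)

/-! ### Shifting a hole along a fan -/

/-- Whether the missing colour of `y` has to be recomputed after its old one has been used, where
`l` is `0` or the successor of a colour that `y` has just lost. -/
def pending (g : Host) (l y : ℕ) : ℕ := if l = 0 then 1 else 1 - small g y (l - 1)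

/-- The state `τ` in which a run of `shift` from the state `σ` with a fan `Y a, …, Y k` has moved
the hole to `Y i` in time `t`. -/
structure Shifted (g : Host) (σ τ : Store) (Y : ℕ → ℕ) (a i k t : ℕ) : Prop where
  low : τ.low = σ.low
  deg : τ.deg = σ.deg
  mark : τ.mark = σ.mark
  reg : ∀ j, j ≠ 4 → j ≠ 7 → j ≠ 9 → j ≠ 10 → τ.r j = σ.r j
  leaf : τ.r 4 = Y i
  colouring : PartialColouring g τ.nbr
  hole : Hole g τ.nbr (σ.r 3) (Y i)
  missing : ∀ p, p ≠ σ.r 3 → τ.nbr p (τ.miss p) = 0 ∧ τ.miss p ≤ g.d p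
  centre : τ.miss (σ.r 3) = σ.miss (σ.r 3)
  fan : Fan τ.nbr τ.miss (σ.r 3) Y i k
  keep : ∀ j, i ≤ j → j ≤ k → τ.miss (Y j) = σ.miss (Y j)
  present : ∀ c, τ.nbr (σ.r 3) c = 0 ↔ σ.nbr (σ.r 3) c = 0
  coloured : insert s(σ.r 3, σ.r 4) (coloured σ.nbr) ⊆ insert s(σ.r 3, Y i) (coloured τ.nbr)
  lost : τ.r 9 ≠ 0 → τ.nbr (Y i) (τ.r 9 - 1) = 0 ∧ τ.r 9 - 1 ≠ τ.miss (Y i)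
  potential_le : potential g σ.nbr ≤ potential g τ.nbr
  time : t + 100 * (g.n + 1) * (potential g σ.nbr + pending g (τ.r 9) (Y i)) ≤
    200 * (i - a) + 100 * (g.n + 1) * (potential g τ.nbr + pending g (σ.r 9) (σ.r 4))

/-- Moving the colour to `Y i` raises the potential by `1 - small g (Y (i + 1)) (τ.miss (Y i))`,
which is exactly the new value of `pending`. Thus a search for a missing colour in the following
round is prepaid by the present gain, and only 200 units per round remain. -/
theorem Shifted.next {σ τ ν : Store} {Y : ℕ → ℕ} {a i k t t' e : ℕ}
    (h : Shifted g σ τ Y a i k t) (hai : a ≤ i) (hi : i < k)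
    (hnbr : ν.nbr = moveColour τ.nbr (σ.r 3) (Y i) (Y (i + 1)) (τ.miss (Y i)))
    (hmiss : ν.miss = Function.update τ.miss (Y i) e) (he : ν.nbr (Y i) e = 0)
    (hle : e ≤ g.d (Y i)) (hlow : ν.low = τ.low) (hdeg : ν.deg = τ.deg) (hmark : ν.mark = τ.mark)
    (h4 : ν.r 4 = Y (i + 1)) (h9 : ν.r 9 = τ.miss (Y i) + 1)
    (hr : ∀ j, j ≠ 4 → j ≠ 7 → j ≠ 9 → j ≠ 10 → ν.r j = τ.r j)
    (ht : t' ≤ t + 200 + 100 * (g.n + 1) * pending g (τ.r 9) (Y i)) :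
    Shifted g σ ν Y a (i + 1) k t' := by
  have hyx : Y i ≠ σ.r 3 := (g.ne h.hole.1).symm
  obtain ⟨m1, m2⟩ := h.missing _ hyx
  have hx := h.fan.step i le_rfl hi
  have mv := moved h.colouring h.hole m1 hx (le_max_of_le_right m2)
  have hwx : Y (i + 1) ≠ σ.r 3 := (g.ne (h.colouring.adj hx)).symm
  have happ := fun p q => moveColour_apply τ.nbr (σ.r 3) (Y i) (Y (i + 1)) (τ.miss (Y i)) p q
  simp only [← hnbr] at happ
  have hcol : PartialColouring g ν.nbr := hnbr ▸ mv.colouring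
  have hhole : Hole g ν.nbr (σ.r 3) (Y (i + 1)) := hnbr ▸ mv.hole
  have hpot := mv.potential
  rw [← hnbr, small_eq_one m2] at hpot
  have hm : ∀ j, i + 1 ≤ j → j ≤ k → ν.miss (Y j) = τ.miss (Y j) := fun j h1 h2 => by
    rw [hmiss, Function.update_of_ne]
    intro hc
    have := h.fan.inj j i (by omega) h2 le_rfl (by omega) hc
    omega
  have hsm := small_le_one (g := g) (Y (i + 1)) (τ.miss (Y i))
  refine ⟨hlow.trans h.low, hdeg.trans h.deg, hmark.trans h.mark, fun j a1 a2 a3 a4 =>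
    (hr j a1 a2 a3 a4).trans (h.reg j a1 a2 a3 a4), h4, hcol, hhole, ?_, ?_, ?_, ?_, ?_, ?_, ?_,
    ?_, ?_⟩
  · intro p hp
    by_cases hpy : p = Y i
    · subst hpy
      rw [hmiss, Function.update_self]
      exact ⟨he, hle⟩
    · rw [hmiss, Function.update_of_ne hpy, happ]
      have := h.missing p hp
      refine ⟨?_, this.2⟩
      split_ifs <;> first | rfl | exact this.1
  · rw [hmiss, Function.update_of_ne hyx.symm]
    exact h.centre
  · refine ⟨fun j h1 h2 => ?_, fun j j' h1 h2 h3 h4 => h.fan.inj j j' (by omega) h2 (by omega) h4⟩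
    have e1 := h.fan.step j (by omega) h2
    rw [hm j h1 h2.le, happ]
    rw [if_neg, e1]
    -- A later fan edge of the moved colour would have to be the edge to `Y (i + 1)`, against the
    -- injectivity of the fan.
    intro hc
    rw [hc, h.fan.step i le_rfl hi] at e1
    have := h.fan.inj (i + 1) (j + 1) (by omega) (by omega) (by omega) (by omega) (by omega)
    omega
  · intro j h1 h2
    rw [hm j h1 h2]
    exact h.keep j (by omega) h2
  · intro c
    rw [← h.present, happ]
    by_cases h1 : c = τ.miss (Y i)
    · rw [if_pos h1, if_neg hyx.symm, if_pos rfl, h1, hx]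
      omega
    · rw [if_neg h1]
  · refine h.coloured.trans (mv.coloured.trans ?_)
    rw [hnbr]
  · intro _
    -- The moved colour was present at `Y (i + 1)`, so it differs from the stored missing colour
    -- there. Using up the stored colour next will leave the lost one missing.
    have e1 := h.colouring.symm (h.fan.step i le_rfl hi)
    have e2 := h.missing _ hwx
    rw [h9, hm _ le_rfl hi, happ]
    refine ⟨?_, fun hc => ?_⟩
    · rw [Nat.add_sub_cancel, if_pos rfl, if_neg mv.ne, if_neg hwx, if_pos rfl]
    · rw [Nat.add_sub_cancel] at hc
      rw [hc] at e1
      omega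
  · have := h.potential_le
    omega
  · have e1 : pending g (ν.r 9) (Y (i + 1)) + potential g τ.nbr = potential g ν.nbr := by
      rw [h9, pending, if_neg (by omega), Nat.add_sub_cancel]
      omega
    have e2 := h.time
    rw [← e1]
    rw [show i + 1 - a = i - a + 1 by omega]
    nlinarith

/-- The two branches match the values of `pending`: if the lost colour is small it becomes the new
missing colour (value `0`), otherwise a search is made (value `1`). -/
theorem shift_vc {σ : Store} {Y : ℕ → ℕ} {a s k : ℕ} (hf : PartialColouring g σ.nbr)
    (hdeg : σ.deg = g.d) (hh : Hole g σ.nbr (σ.r 3) (σ.r 4))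
    (hmiss : ∀ p, p ≠ σ.r 3 → σ.nbr p (σ.miss p) = 0 ∧ σ.miss p ≤ g.d p)
    (hfan : Fan σ.nbr σ.miss (σ.r 3) Y a k) (h4 : σ.r 4 = Y a) (h8 : σ.r 8 = Y s) (has : a ≤ s)
    (hsk : s ≤ k) (h9 : σ.r 9 ≠ 0 → σ.nbr (σ.r 4) (σ.r 9 - 1) = 0 ∧ σ.r 9 - 1 ≠ σ.miss (σ.r 4))
    {Q : Store → ℕ → Prop}
    (hQ : ∀ τ t, Shifted g σ τ Y a s k t → Q τ (t + 6)) :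
    shift.vc σ Q := by
  simp only [shift, Cmd.vc]
  refine (Cmd.runs_loop (fun idx τ t => ∃ i, idx + i = s ∧ a ≤ i ∧ Shifted g σ τ Y a i k t)
    ?_ (i := s - a) ⟨a, by omega, le_rfl, ?_⟩).mono ?_
  · rintro idx τ t ⟨i, h1, h2, h⟩ he P hP
    have e3 := h.reg 3 (by decide) (by decide) (by decide) (by decide)
    have e8 := h.reg 8 (by decide) (by decide) (by decide) (by decide)
    have hi : i < s := by
      by_contra hc
      have : i = s := by omega
      subst this
      simp [AExpr.eval, Op.eval, h.leaf, e8, h8] at he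
    have hyx : Y i ≠ σ.r 3 := (g.ne h.hole.1).symm
    obtain ⟨m1, m2⟩ := h.missing _ hyx
    have hx := h.fan.step i le_rfl (by omega)
    have mv := moved h.colouring h.hole m1 hx (le_max_of_le_right m2)
    have hnext := @Shifted.next g σ τ
    simp only [AExpr.cost] at hP
    simp only [Cmd.vc, AExpr.eval, AExpr.cost, Op.eval, Function.update_apply, ne_eq, unlinkCmd,
      linkCmd, OfNat.ofNat_ne_one, not_false_eq_true, true_and,
      Nat.reduceEqDiff, if_true, if_false, e3, h.leaf, hx, Nat.add_sub_cancel, h.deg, hdeg]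
    refine ⟨fun hl => ?_, fun hl => rescan_vc (g := g) mv.colouring 4 fun e t' he hle ht' => ?_⟩
    · have hl' : 0 < τ.r 9 ∧ τ.r 9 < g.d (Y i) + 2 := by
        constructor <;> by_contra hc <;> simp [hc] at hl
      obtain ⟨l1, l2⟩ := h.lost (by omega)
      have hp : pending g (τ.r 9) (Y i) = 0 := by
        rw [pending, if_neg (by omega), small_eq_one (by omega)]
      refine hP _ _ (idx - 1) (by omega) ⟨i + 1, by omega, by omega,
        hnext (e := τ.r 9 - 1) h h2 (by omega) rfl rfl ?_ (by omega) rfl (by rw [h.deg, hdeg]) rfl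
          (by simp) (by simp) ?_ (by rw [hp]; omega)⟩
      · refine (moveColour_apply τ.nbr (σ.r 3) (Y i) (Y (i + 1)) (τ.miss (Y i)) _ _).trans ?_
        rw [if_neg l2, l1]
      · intro j a1 a2 a3 a4
        simp [a1, a2, a3, a4]
    · have hl' : ¬ (0 < τ.r 9 ∧ τ.r 9 < g.d (Y i) + 2) := by
        rintro ⟨hc1, hc2⟩
        simp [hc1, hc2] at hl
      have hp : pending g (τ.r 9) (Y i) = 1 := by
        rw [pending]
        split_ifs with h0
        · rfl
        · rw [small_eq_zero (by omega)]
      simp only [Function.update_apply, Nat.reduceEqDiff, if_false, h.leaf] at he hle ⊢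
      refine hP _ _ (idx - 1) (by omega) ⟨i + 1, by omega, by omega,
        hnext (e := e) h h2 (by omega) rfl rfl he hle rfl (by rw [h.deg, hdeg]) rfl
          (by simp) (by simp) ?_ (by rw [hp]; omega)⟩
      intro j a1 a2 a3 a4
      simp [a1, a2, a3, a4]
  · refine ⟨rfl, rfl, rfl, fun _ _ _ _ _ => rfl, h4, hf, h4 ▸ hh, hmiss, rfl, hfan,
      fun _ _ _ => rfl, fun _ => Iff.rfl, by rw [h4], by rw [← h4]; exact h9, le_rfl, ?_⟩
    rw [h4]
    omega
  · rintro τ _ ⟨idx, t, ⟨i, h1, h2, h⟩, he, rfl⟩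
    have e8 := h.reg 8 (by decide) (by decide) (by decide) (by decide)
    have : Y i = Y s := by
      by_contra hc
      simp [AExpr.eval, Op.eval, h.leaf, e8, h8, hc] at he
    have := h.fan.inj i s le_rfl (by omega) (by omega) hsk this
    subst this
    exact hQ τ t h

/-! ### Alternating paths -/

/-- The edge from `x` to `p` of a colouring `f₁` has the colour `δ`, and `α` is missing at `x`.
The colouring `f` arises when that edge loses its colour and the resulting hole is moved along the
alternating path with the colours `α` and `δ` to the edge `uv`. The colours `a` and `b` are missing
at `u` and `v`, and `X` is the set of the vertices visited so far. -/
structure Walk (g : Host) (f₁ f : ℕ → ℕ → ℕ) (x p α δ u v a b : ℕ) (X : Finset ℕ) : Prop where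
  colouring : PartialColouring g f
  hole : Hole g f u v
  colours : (a = α ∧ b = δ) ∨ (a = δ ∧ b = α)
  missing_left : f u a = 0
  missing_right : f v b = 0
  le : a ≤ max (g.d u) (g.d v)
  other : ∀ q c, c ≠ α → c ≠ δ → f q c = f₁ q c
  same : ∀ q, q ≠ x → q ≠ u → q ≠ v → ∀ c, f q c = 0 ↔ f₁ q c = 0
  right_ne : v ≠ x
  right : f v a = 0 ↔ f₁ v a = 0
  right_had : f₁ v b ≠ 0
  left : u ≠ x → (f u b = 0 ↔ f₁ u b = 0) ∧ f₁ u a ≠ 0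
  start : f x δ = 0
  first : u = x → v = p ∧ a = α ∧ b = δ
  later : u ≠ x → f x α = p + 1
  mem_left : u ∈ X
  mem_right : v ∈ X
  mem_start : x ∈ X
  subset : X ⊆ Finset.range g.n
  closed : ∀ q ∈ X, q ≠ v → ∀ c, c = α ∨ c = δ → ∀ q', f q c = q' + 1 → q' ∈ X ∧ q' ≠ v
  potential : potential g f + small g u a + small g v b + small g x δ = potential g f₁ + 1
  coloured : coloured f₁ ⊆ insert s(u, v) (coloured f)

/-- The extra `1` in the potential identity is `small g x α`: the colour `α` is small at `x` and
initially plays the role of `a` at `u = x`. -/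
theorem Walk.init {f₁ : ℕ → ℕ → ℕ} (hf : PartialColouring g f₁) {x p α δ : ℕ}
    (hα : f₁ x α = 0) (hle : α ≤ g.d x) (hδ : f₁ x δ = p + 1) :
    Walk g f₁ (unlink f₁ x p δ) x p α δ x p α δ {x, p} := by
  have hαδ : α ≠ δ := by rintro rfl; omega
  have hadj := hf.adj hδ
  have hne := g.ne hadj
  have hp := potential_unlink hf hδ
  have hs := hf.symm hδ
  constructor
  · exact hf.unlink hδ
  · refine ⟨hadj, fun c hc => ?_⟩
    rw [unlink_apply] at hc
    split_ifs at hc with h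
    exact h ⟨hf.inj hc hδ, Or.inl rfl⟩
  · exact Or.inl ⟨rfl, rfl⟩
  · rw [unlink_apply, if_neg (fun h => hαδ h.1), hα]
  · simp [unlink_apply]
  · exact le_max_of_le_left hle
  · intro q c h1 h2
    rw [unlink_apply, if_neg (fun h => h2 h.1)]
  · intro q h1 h2 h3 c
    rw [unlink_apply, if_neg (by tauto)]
  · exact hne.symm
  · rw [unlink_apply, if_neg (fun h => hαδ h.1)]
  · omega
  · exact fun h => absurd rfl h
  · simp [unlink_apply]
  · exact fun _ => ⟨rfl, rfl, rfl⟩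
  · exact fun h => absurd rfl h
  · simp
  · simp
  · simp
  · intro q hq
    simp only [Finset.mem_insert, Finset.mem_singleton] at hq
    rcases hq with rfl | rfl
    · exact Finset.mem_range.2 (g.lt hadj)
    · exact Finset.mem_range.2 (g.lt (g.symm hadj))
  · intro q hq hqp c hc q' h
    simp only [Finset.mem_insert, Finset.mem_singleton] at hq
    obtain rfl : q = x := by tauto
    rw [unlink_apply] at h
    split_ifs at h with h1
    rcases hc with rfl | rfl
    · omega
    · exact absurd ⟨rfl, Or.inl rfl⟩ h1
  · rw [small_eq_one hle]
    omega
  · exact coloured_unlink hf hδ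

/-- The colour `a` passes from `vw` to `uv`, and the missing colours exchange roles at the new hole
`vw`. The bound on `b` says that `b` is admissible there. The change of potential is absorbed
exactly by the `small` terms of the invariant. -/
theorem Walk.next {f₁ f : ℕ → ℕ → ℕ} {x p α δ u v a b w : ℕ} {X : Finset ℕ}
    (h : Walk g f₁ f x p α δ u v a b X) (hαδ : α ≠ δ) (hw : f v a = w + 1)
    (hb : b ≤ max (g.d v) (g.d w)) :
    Walk g f₁ (moveColour f v u w a) x p α δ v w b a (insert w X) ∧ w ∉ X := by
  have hab : a ≠ b := by rcases h.colours with ⟨rfl, rfl⟩ | ⟨rfl, rfl⟩ <;> tauto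
  have ha : a = α ∨ a = δ := by rcases h.colours with h | h <;> tauto
  have hb' : b = α ∨ b = δ := by rcases h.colours with h | h <;> tauto
  have hc : ∀ c, (c = α ∨ c = δ) ↔ (c = a ∨ c = b) := by
    intro c; rcases h.colours with ⟨rfl, rfl⟩ | ⟨rfl, rfl⟩ <;> tauto
  have hu := h.hole.symm h.colouring
  have huv := g.ne h.hole.1
  have mv := moved h.colouring hu h.missing_left hw (by rw [max_comm]; exact h.le)
  have hwv : v ≠ w := g.ne (h.colouring.adj hw)
  have hws := h.colouring.symm hw
  -- This makes the path simple: for visited vertices other than the head `v`, path neighbours are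
  -- visited and are not `v`, whereas the neighbour of `w` in the colour `a` is `v`.
  have hwX : w ∉ X := fun hX => (h.closed w hX hwv.symm a ha v hws).2 rfl
  have hwu : w ≠ u := mv.ne
  have hwx : w ≠ x := fun e => hwX (e ▸ h.mem_start)
  have app := moveColour_apply f v u w a
  have vb := h.missing_right
  have va1 : f₁ v a ≠ 0 := fun e => by rw [← h.right] at e; omega
  have wsame := h.same w hwx hwu hwv.symm
  refine ⟨?_, hwX⟩
  constructor
  · exact mv.colouring
  · exact mv.hole
  · rcases h.colours with h | h
    · exact Or.inr ⟨h.2, h.1⟩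
    · exact Or.inl ⟨h.2, h.1⟩
  · rw [app, if_neg hab.symm, vb]
  · rw [app, if_pos rfl, if_neg hwu, if_neg hwv.symm, if_pos rfl]
  · exact hb
  · intro q c h1 h2
    rw [app, if_neg (by rintro rfl; tauto), h.other q c h1 h2]
  · intro q h1 h2 h3 c
    rw [app]
    by_cases hca : c = a
    · rw [if_pos hca]
      by_cases hqu : q = u
      · subst hqu
        rw [if_pos rfl, hca]
        -- An inner vertex `u` had the colour `a` originally and now regains it, so its set of
        -- missing colours is restored.
        have := (h.left h1).2
        omega
      · rw [if_neg hqu, if_neg h2, if_neg h3]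
        exact h.same q h1 hqu h2 c
    · rw [if_neg hca]
      by_cases hqu : q = u
      · subst hqu
        by_cases hcb : c = b
        · rw [hcb]
          exact (h.left h1).1
        · rw [h.other]
          · intro e; exact absurd ((hc c).1 (Or.inl e)) (by tauto)
          · intro e; exact absurd ((hc c).1 (Or.inr e)) (by tauto)
      · exact h.same q h1 hqu h2 c
  · exact hwx
  · rw [app, if_neg hab.symm]
    exact wsame b
  · intro e
    rw [← wsame] at e
    omega
  · intro _
    refine ⟨?_, h.right_had⟩
    rw [app, if_pos rfl, if_neg huv.symm, if_pos rfl]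
    omega
  · rw [app]
    by_cases hδa : δ = a
    · rw [if_pos hδa, if_neg, if_neg h.right_ne.symm, if_neg hwx.symm, h.start]
      intro e
      have := h.first e.symm
      exact hαδ (by omega)
    · rw [if_neg hδa, h.start]
  · exact fun e => absurd e h.right_ne
  · intro _
    rw [app]
    by_cases hux : u = x
    · obtain ⟨rfl, rfl, rfl⟩ := h.first hux
      rw [if_pos rfl, if_pos hux.symm]
    · rw [if_neg (Ne.symm hux), if_neg h.right_ne.symm, if_neg hwx.symm, h.later hux, ite_self]
  · exact Finset.mem_insert_of_mem h.mem_right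
  · exact Finset.mem_insert_self _ _
  · exact Finset.mem_insert_of_mem h.mem_start
  · exact Finset.insert_subset (Finset.mem_range.2 (g.lt (h.colouring.adj hws))) h.subset
  · intro q hq hqw c hc' q' e
    have hqX : q ∈ X := Finset.mem_of_mem_insert_of_ne hq hqw
    have key : q' ∈ X → q' ∈ insert w X ∧ q' ≠ w := fun hX =>
      ⟨Finset.mem_insert_of_mem hX, fun e => hwX (e ▸ hX)⟩
    apply key
    rw [app] at e
    by_cases hca : c = a
    · rw [if_pos hca] at e
      by_cases hqu : q = u
      · rw [if_pos hqu] at e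
        obtain rfl : v = q' := by omega
        exact h.mem_right
      · rw [if_neg hqu] at e
        by_cases hqv : q = v
        · rw [if_pos hqv] at e
          obtain rfl : u = q' := by omega
          exact h.mem_left
        · rw [if_neg hqv, if_neg hqw] at e
          exact (h.closed q hqX hqv c hc' q' e).1
    · rw [if_neg hca] at e
      by_cases hqv : q = v
      · have : c = b := by have := (hc c).1 hc'; tauto
        rw [hqv, this] at e
        omega
      · exact (h.closed q hqX hqv c hc' q' e).1
  · have := h.potential
    have := mv.potential
    omega
  · refine h.coloured.trans ?_
    rw [Sym2.eq_swap]
    exact mv.coloured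

/-- The effect of a walk that closes its hole at the vertex `v`. -/
structure WalkClosed (g : Host) (f₁ f : ℕ → ℕ → ℕ) (x p α δ v a b : ℕ) : Prop where
  colouring : PartialColouring g f
  colours : (a = α ∧ b = δ) ∨ (a = δ ∧ b = α)
  other : ∀ q c, c ≠ α → c ≠ δ → f q c = f₁ q c
  same : ∀ q, q ≠ x → q ≠ v → ∀ c, f q c = 0 ↔ f₁ q c = 0
  end_missing : f v b = 0
  start : f x δ = 0
  first : f x α = p + 1
  potential : potential g f + small g v b + small g x δ = potential g f₁ + 1 + small g v a
  coloured : coloured f₁ ⊆ coloured f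

/-- Only the end `v` and `x` may now miss other colours than before: `v` has exchanged `b` for `a`,
and `x` has exchanged `δ` for `α`. Closing gains `small g u a`, which cancels in the invariant. -/
theorem Walk.close {f₁ f : ℕ → ℕ → ℕ} {x p α δ u v a b : ℕ} {X : Finset ℕ}
    (h : Walk g f₁ f x p α δ u v a b X) (hαδ : α ≠ δ) (hv : f v a = 0) :
    WalkClosed g f₁ (link f u v a) x p α δ v a b := by
  have hab : a ≠ b := by rcases h.colours with ⟨rfl, rfl⟩ | ⟨rfl, rfl⟩ <;> tauto
  have ha : a = α ∨ a = δ := by rcases h.colours with h | h <;> tauto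
  have hc : ∀ c, (c = α ∨ c = δ) ↔ (c = a ∨ c = b) := by
    intro c; rcases h.colours with ⟨rfl, rfl⟩ | ⟨rfl, rfl⟩ <;> tauto
  have huv := g.ne h.hole.1
  have app := link_apply f u v a
  constructor
  · exact h.colouring.link h.hole h.missing_left hv h.le
  · exact h.colours
  · intro q c h1 h2
    rw [app, if_neg (by rintro rfl; tauto), h.other q c h1 h2]
  · intro q h1 h2 c
    rw [app]
    by_cases hca : c = a
    · rw [if_pos hca, if_neg h2]
      by_cases hqu : q = u
      · subst hqu
        rw [if_pos rfl, hca]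
        have := (h.left h1).2
        omega
      · rw [if_neg hqu]
        exact h.same q h1 hqu h2 c
    · rw [if_neg hca]
      by_cases hqu : q = u
      · subst hqu
        by_cases hcb : c = b
        · rw [hcb]
          exact (h.left h1).1
        · rw [h.other]
          · intro e; exact absurd ((hc c).1 (Or.inl e)) (by tauto)
          · intro e; exact absurd ((hc c).1 (Or.inr e)) (by tauto)
      · exact h.same q h1 hqu h2 c
  · rw [app, if_neg hab.symm, h.missing_right]
  · rw [app]
    by_cases hδa : δ = a
    · rw [if_pos hδa, if_neg h.right_ne.symm, if_neg, h.start]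
      intro e
      have := h.first e.symm
      exact hαδ (by omega)
    · rw [if_neg hδa, h.start]
  · rw [app]
    by_cases hux : u = x
    · obtain ⟨rfl, rfl, rfl⟩ := h.first hux
      rw [if_pos rfl, if_neg (by omega), if_pos hux.symm]
    · rw [if_neg h.right_ne.symm, if_neg (Ne.symm hux), h.later hux, ite_self]
  · have := h.potential
    have := potential_link h.hole.1 h.missing_left hv
    omega
  · exact h.coloured.trans (coloured_link huv h.missing_left hv)

/-- The outcome of `walk`. -/
structure WalkEnd (g : Host) (f₁ : ℕ → ℕ → ℕ) (p : ℕ) (σ τ : Store) : Prop where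
  low : τ.low = σ.low
  deg : τ.deg = σ.deg
  miss : τ.miss = σ.miss
  mark : τ.mark = σ.mark
  reg : ∀ i, i ≠ 5 → i ≠ 7 → i ≠ 11 → i ≠ 12 → i ≠ 13 → i ≠ 14 → i ≠ 15 → i ≠ 17 →
    τ.r i = σ.r i
  outcome : (τ.r 5 = 0 ∧ ∃ a b,
      WalkClosed g f₁ τ.nbr (σ.r 3) p (σ.r 13) (σ.r 14) (τ.r 12) a b) ∨
    (τ.r 5 = σ.r 5 ∧ ∃ a b X, g.d (τ.r 12) < b ∧
      Walk g f₁ τ.nbr (σ.r 3) p (σ.r 13) (σ.r 14) (τ.r 11) (τ.r 12) a b X)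

/-- Every round adds a new vertex to `X`, so there are `O(n)` rounds. Of the stopping condition only
`g.d v < b` is kept; it makes the term `small g v b` vanish. -/
theorem walk_vc {σ : Store} {f₁ : ℕ → ℕ → ℕ} {p : ℕ} {X : Finset ℕ} (hdeg : σ.deg = g.d)
    (hw : Walk g f₁ σ.nbr (σ.r 3) p (σ.r 13) (σ.r 14) (σ.r 11) (σ.r 12) (σ.r 13) (σ.r 14) X)
    (hαδ : σ.r 13 ≠ σ.r 14) (h15 : σ.r 15 = 1)
    {Q : Store → ℕ → Prop} (hQ : ∀ τ t, WalkEnd g f₁ p σ τ → t ≤ 200 * (g.n + 2) → Q τ t) :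
    walk.vc σ Q := by
  simp only [walk, Cmd.vc]
  refine (Cmd.runs_loop (fun idx τ t => (τ.low = σ.low ∧ τ.deg = σ.deg ∧ τ.miss = σ.miss ∧
    τ.mark = σ.mark ∧ ∀ i, i ≠ 5 → i ≠ 7 → i ≠ 11 → i ≠ 12 → i ≠ 13 → i ≠ 14 → i ≠ 15 → i ≠ 17 →
    τ.r i = σ.r i) ∧
    ((τ.r 15 = 1 ∧ τ.r 5 = σ.r 5 ∧ ∃ X, idx + X.card = g.n + 1 ∧ t ≤ 180 * X.card ∧
      Walk g f₁ τ.nbr (σ.r 3) p (σ.r 13) (σ.r 14) (τ.r 11) (τ.r 12) (τ.r 13) (τ.r 14) X) ∨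
     (τ.r 15 = 0 ∧ idx = 0 ∧ t ≤ 180 * (g.n + 1) ∧ WalkEnd g f₁ p σ τ)))
    ?_ (i := g.n + 1 - X.card) ?_).mono ?_
  · rintro idx τ t ⟨⟨h1, h2, h3, h4, h5⟩, h⟩ he P hP
    simp only [AExpr.eval, AExpr.cost] at he hP
    obtain ⟨h6, h7, X, h8, h9, h⟩ | ⟨h6, -⟩ := h
    swap
    · exact absurd h6 he
    have hX := Finset.card_le_card h.subset
    rw [Finset.card_range] at hX
    simp only [Cmd.vc, AExpr.eval, AExpr.cost, Op.eval, Function.update_apply, ne_eq, unlinkCmd,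
      linkCmd, OfNat.ofNat_ne_one, not_false_eq_true, true_and,
      Nat.reduceEqDiff, if_true, if_false, h2, hdeg]
    refine ⟨fun hw => ⟨fun hb => ?_, fun hb => ?_⟩, fun hw => ?_⟩
    · have hb' : g.d (τ.r 12) < τ.r 14 := by
        by_contra hc
        simp [hc] at hb
      have hfr : ∀ i, i ≠ 5 → i ≠ 7 → i ≠ 11 → i ≠ 12 → i ≠ 13 → i ≠ 14 → i ≠ 15 → i ≠ 17 →
          Function.update (Function.update (Function.update τ.r 7 (τ.nbr (τ.r 12) (τ.r 13))) 7
            (τ.nbr (τ.r 12) (τ.r 13) - 1)) 15 0 i = σ.r i := by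
        intro i a1 a2 a3 a4 a5 a6 a7 a8
        simp [a2, a7, h5 i a1 a2 a3 a4 a5 a6 a7 a8]
      refine hP _ _ 0 (by omega) ⟨⟨h1, hdeg ▸ rfl, h3, h4, hfr⟩, Or.inr ⟨by simp, rfl, by omega,
        h1, hdeg ▸ rfl, h3, h4, hfr, Or.inr ⟨by simpa using h7, τ.r 13, τ.r 14, X, ?_⟩⟩⟩
      simpa using ⟨hb', h⟩
    · have hb' : τ.r 14 ≤ max (g.d (τ.r 12)) (g.d (τ.nbr (τ.r 12) (τ.r 13) - 1)) := by
        by_contra hc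
        rw [not_le, max_lt_iff] at hc
        simp [hc] at hb
      obtain ⟨hn, hwX⟩ := h.next (w := τ.nbr (τ.r 12) (τ.r 13) - 1) hαδ (by omega) hb'
      have hcard := Finset.card_insert_of_notMem hwX
      have hX' := Finset.card_le_card hn.subset
      rw [Finset.card_range] at hX'
      refine hP _ _ (idx - 1) (by omega) ⟨⟨h1, hdeg ▸ rfl, h3, h4, ?_⟩, Or.inl ⟨by simpa using h6,
        by simpa using h7, insert (τ.nbr (τ.r 12) (τ.r 13) - 1) X, by omega, by omega, ?_⟩⟩
      · intro i a1 a2 a3 a4 a5 a6 a7 a8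
        simp [a2, a3, a4, a5, a6, a8, h5 i a1 a2 a3 a4 a5 a6 a7 a8]
      · simpa [moveColour, link, unlink] using hn
    · have hc := h.close hαδ hw
      have hfr : ∀ i, i ≠ 5 → i ≠ 7 → i ≠ 11 → i ≠ 12 → i ≠ 13 → i ≠ 14 → i ≠ 15 → i ≠ 17 →
          Function.update (Function.update (Function.update τ.r 7 (τ.nbr (τ.r 12) (τ.r 13))) 5
            0) 15 0 i = σ.r i := by
        intro i a1 a2 a3 a4 a5 a6 a7 a8
        simp [a1, a2, a7, h5 i a1 a2 a3 a4 a5 a6 a7 a8]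
      refine hP _ _ 0 (by omega) ⟨⟨h1, hdeg ▸ rfl, h3, h4, hfr⟩, Or.inr ⟨by simp, rfl, by omega,
        h1, hdeg ▸ rfl, h3, h4, hfr, Or.inl ⟨by simp, τ.r 13, τ.r 14, ?_⟩⟩⟩
      simpa [link] using hc
  · have hX := Finset.card_le_card hw.subset
    rw [Finset.card_range] at hX
    exact ⟨⟨rfl, rfl, rfl, rfl, fun _ _ _ _ _ _ _ _ _ => rfl⟩, Or.inl ⟨h15, rfl, X, by omega,
      by omega, hw⟩⟩
  · rintro τ _ ⟨idx, t, ⟨-, h⟩, he, rfl⟩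
    simp only [AExpr.eval, AExpr.cost] at he ⊢
    obtain ⟨h9, -⟩ | ⟨-, -, h10, h11⟩ := h
    · omega
    exact hQ τ _ h11 (by omega)

/-! ### Turning back to the fan and closing its hole -/

/-- The hole between `x` and the vertex in register `8` can be closed with the colour `c`, after
which `uv` is the only hole if `h = 1`, and there is none if `h = 0`. Before, the colouring was
`f₁`, with the hole `xy`. -/
structure Ready (g : Host) (f₁ : ℕ → ℕ → ℕ) (x y c u v h : ℕ) (ν : Store) : Prop where
  colouring : PartialColouring g ν.nbr
  hole : Hole g ν.nbr x (ν.r 8)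
  centre : ν.nbr x c = 0
  leaf : ν.nbr (ν.r 8) c = 0
  le : c ≤ g.d (ν.r 8)
  missing : ∀ p, p ≠ x → p ≠ u → p ≠ v → p ≠ ν.r 8 →
    ν.nbr p (ν.miss p) = 0 ∧ ν.miss p ≤ g.d p
  outcome : (h = 0 ∧ insert s(x, y) (coloured f₁) ⊆ insert s(x, ν.r 8) (coloured ν.nbr)) ∨
    (h = 1 ∧ Hole g ν.nbr u v ∧ (u = x → v ≠ ν.r 8) ∧ v ≠ x ∧
      insert s(x, y) (coloured f₁) ⊆ insert s(u, v) (insert s(x, ν.r 8) (coloured ν.nbr)))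
  potential : potential g f₁ ≤ potential g ν.nbr + small g x c

/-- The outcome of `finish`. -/
structure Finished (g : Host) (f₁ : ℕ → ℕ → ℕ) (x y c : ℕ) (σ τ : Store) : Prop where
  low : τ.low = σ.low
  deg : τ.deg = σ.deg
  mark : τ.mark = σ.mark
  reg : ∀ i, i ≠ 3 → i ≠ 4 → τ.r i = σ.r i
  colouring : PartialColouring g τ.nbr
  missing : ∀ p, τ.nbr p (τ.miss p) = 0 ∧ τ.miss p ≤ g.d p
  outcome : (τ.r 5 = 0 ∧ insert s(x, y) (coloured f₁) ⊆ coloured τ.nbr) ∨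
    (τ.r 5 = 1 ∧ Hole g τ.nbr (τ.r 3) (τ.r 4) ∧
      insert s(x, y) (coloured f₁) ⊆ insert s(τ.r 3, τ.r 4) (coloured τ.nbr))
  potential : potential g τ.nbr = potential g σ.nbr + small g x c + 1

/-- Missing colours can have become invalid only at `x`, `u`, `v` and the vertex in register `8`, so
four searches repair them all. -/
theorem finish_vc {f₁ : ℕ → ℕ → ℕ} {x y c u v h : ℕ} {σ : Store}
    (hr : Ready g f₁ x y c u v h σ) (h3 : σ.r 3 = x) (h10 : σ.r 10 = c) (h11 : σ.r 11 = u)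
    (h12 : σ.r 12 = v) (h5 : σ.r 5 = h) {Q : Store → ℕ → Prop}
    (hQ : ∀ τ t, Finished g f₁ x y c σ τ → t ≤ 600 * (g.n + 1) → Q τ t) :
    finish.vc σ Q := by
  have hc := hr.colouring.link hr.hole hr.centre hr.leaf (le_max_of_le_right hr.le)
  have app := link_apply σ.nbr x (σ.r 8) c
  have hne := g.ne hr.hole.1
  have hpot := potential_link hr.hole.1 hr.centre hr.leaf
  rw [small_eq_one hr.le] at hpot
  simp only [finish, Cmd.vc, linkCmd, AExpr.eval, AExpr.cost, Op.eval, h3, h10]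
  refine rescan_vc (g := g) hc 3 fun c₁ t₁ e₁ l₁ ht₁ => ?_
  refine rescan_vc (g := g) hc 11 fun c₂ t₂ e₂ l₂ ht₂ => ?_
  refine rescan_vc (g := g) hc 12 fun c₃ t₃ e₃ l₃ ht₃ => ?_
  refine rescan_vc (g := g) hc 8 fun c₄ t₄ e₄ l₄ ht₄ => ?_
  simp only [h3, h11, h12] at e₁ e₂ e₃ e₄ l₁ l₂ l₃ l₄ ⊢
  refine ⟨by decide, by decide, hQ _ _ ?_ (by omega)⟩
  refine ⟨rfl, rfl, rfl, ?_, hc, ?_, ?_, hpot⟩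
  · intro i a1 a2
    simp [a1, a2]
  · intro p
    simp only [Function.update_apply]
    by_cases p8 : p = σ.r 8
    · rw [if_pos p8, p8]; exact ⟨e₄, l₄⟩
    rw [if_neg p8]
    by_cases pv : p = v
    · rw [if_pos pv, pv]; exact ⟨e₃, l₃⟩
    rw [if_neg pv]
    by_cases pu : p = u
    · rw [if_pos pu, pu]; exact ⟨e₂, l₂⟩
    rw [if_neg pu]
    by_cases px : p = x
    · rw [if_pos px, px]; exact ⟨e₁, l₁⟩
    rw [if_neg px]
    obtain ⟨m1, m2⟩ := hr.missing p px pu pv p8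
    refine ⟨(app p (σ.miss p)).trans ?_, m2⟩
    rw [if_neg p8, if_neg px, m1, ite_self]
  · have hcol := coloured_link hne hr.centre hr.leaf
    simp only [Function.update_apply, Nat.reduceEqDiff, if_true, if_false, h12, h5]
    rcases hr.outcome with ⟨o1, o2⟩ | ⟨o1, o2, o3, o4, o5⟩
    · exact Or.inl ⟨o1, o2.trans hcol⟩
    -- The hole `uv` stays uncoloured because it is not the edge being closed.
    · refine Or.inr ⟨o1, ⟨o2.1, fun c' e => ?_⟩, o5.trans (Set.insert_subset_insert hcol)⟩
      have e' := (app u c').symm.trans e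
      have := o2.2 c'
      split_ifs at e' with h1 h2 h3
      · omega
      · exact o3 h3 (by omega)
      · exact this e'
      · exact this e'

/-- The part of the state that `turn` does not change. -/
structure TurnFrame (σ τ : Store) : Prop where
  low : τ.low = σ.low
  deg : τ.deg = σ.deg
  mark : τ.mark = σ.mark
  reg : ∀ i, i ≠ 4 → i ≠ 7 → i ≠ 8 → i ≠ 9 → i ≠ 10 → τ.r i = σ.r i

/-- If `δ` is still missing at `Y s`, nothing has to be done. Otherwise the path ended there: now
`α` is missing at `Y s` and the edge from `x` to `Y (s + 1)` has the colour `α`. Moving `α` to `x Y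
s` puts the hole at `Y (s + 1)`, and the rest of the fan carries it to `Y k`, which misses `δ` too.
-/
theorem turn_vc {f₁ : ℕ → ℕ → ℕ} {Y : ℕ → ℕ} {s k : ℕ} {ρ σ : Store} (hf : PartialColouring g f₁)
    (hsk : s < k) (hfan : Fan f₁ ρ.miss (ρ.r 3) Y s k) (hhole : Hole g f₁ (ρ.r 3) (Y s))
    (hmiss : ∀ p, f₁ p (ρ.miss p) = 0 ∧ ρ.miss p ≤ g.d p)
    (hst : ρ.miss (Y s) = ρ.miss (Y k)) (hdeg : ρ.deg = g.d)
    (h13 : ρ.r 13 = ρ.miss (ρ.r 3)) (h14 : ρ.r 14 = ρ.miss (Y s)) (h18 : ρ.r 18 = ρ.miss (Y s))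
    (h8 : ρ.r 8 = Y s) (h6 : ρ.r 6 = Y k) (h5 : ρ.r 5 = 1)
    (hw : WalkEnd g f₁ (Y (s + 1)) ρ σ) {Q : Store → ℕ → Prop}
    (hQ : ∀ τ t, TurnFrame σ τ →
      Ready g f₁ (ρ.r 3) (Y s) (ρ.miss (Y s)) (σ.r 11) (σ.r 12) (σ.r 5) τ →
      t + 100 * (g.n + 1) * potential g f₁ ≤ 1000 * (g.n + 1) +
        100 * (g.n + 1) * (potential g τ.nbr + small g (ρ.r 3) (ρ.miss (Y s))) → Q τ t) :
    turn.vc σ Q := by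
  have hreg := hw.reg
  have e3 := hreg 3 (by decide) (by decide) (by decide) (by decide) (by decide) (by decide)
    (by decide) (by decide)
  have e6 := hreg 6 (by decide) (by decide) (by decide) (by decide) (by decide) (by decide)
    (by decide) (by decide)
  have e8 := hreg 8 (by decide) (by decide) (by decide) (by decide) (by decide) (by decide)
    (by decide) (by decide)
  have e18 := hreg 18 (by decide) (by decide) (by decide) (by decide) (by decide) (by decide)
    (by decide) (by decide)
  have hmi := hw.miss
  have hde := hw.deg
  set x := ρ.r 3 with hx
  set δ := ρ.miss (Y s) with hδ
  set α := ρ.miss x with hα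
  rw [h6] at e6
  rw [h8] at e8
  rw [h18] at e18
  have hout := hw.outcome
  rw [h13, h14, ← hx, h5] at hout
  have f1δ : f₁ x δ = Y (s + 1) + 1 := hfan.step s le_rfl hsk
  have f1α : f₁ x α = 0 := (hmiss x).1
  have hαδ : α ≠ δ := by intro e; rw [e] at f1α; omega
  have hyx : Y s ≠ x := (g.ne hhole.1).symm
  have f1y : f₁ (Y s) δ = 0 := (hmiss _).1
  have hpy : Y (s + 1) ≠ Y s := fun e => hhole.2 δ (by rw [f1δ, e])
  have hpx : Y (s + 1) ≠ x := (g.ne (hf.adj f1δ)).symm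
  simp only [turn, Cmd.vc, AExpr.eval, AExpr.cost, Op.eval, Function.update_apply, ne_eq, unlinkCmd,
      linkCmd, OfNat.ofNat_ne_one, not_false_eq_true, true_and, Nat.reduceEqDiff, if_true, if_false,
      e3, e8, e18, hmi]
  refine ⟨fun hret => ?_, fun hret => ?_⟩
  · obtain ⟨o5, a, b, wc⟩ | ⟨o5, a, b, X, hb, wk⟩ := hout
    swap
    -- A stuck walk never takes `δ` away from the colours missing at `Y s`, whether `Y s` is off the
    -- hole or is one of its two ends.
    · exfalso
      apply hret
      by_cases hu : Y s = σ.r 11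
      · rcases wk.colours with ⟨rfl, rfl⟩ | ⟨rfl, rfl⟩
        · exact hu ▸ ((wk.left (hu ▸ hyx)).1.2 (hu ▸ f1y))
        · exact hu ▸ wk.missing_left
      · by_cases hv : Y s = σ.r 12
        · rcases wk.colours with ⟨rfl, rfl⟩ | ⟨rfl, rfl⟩
          · exact hv ▸ wk.missing_right
          · exact hv ▸ (wk.right.2 (hv ▸ f1y))
        · exact (wk.same _ hyx hu hv δ).2 f1y
    have hv : Y s = σ.r 12 := by
      by_contra hv
      exact hret ((wc.same _ hyx hv δ).2 f1y)
    rw [← hv] at wc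
    obtain ⟨rfl, rfl⟩ : a = δ ∧ b = α := by
      rcases wc.colours with ⟨rfl, rfl⟩ | h
      · exact absurd wc.end_missing hret
      · exact h
    have hhole' : Hole g σ.nbr x (Y s) := by
      refine ⟨hhole.1, fun c e => ?_⟩
      by_cases h1 : c = α
      · rw [h1, wc.first] at e; omega
      by_cases h2 : c = δ
      · rw [h2, wc.start] at e; omega
      rw [wc.other x c h1 h2] at e
      exact hhole.2 c e
    have mv := moved wc.colouring hhole' wc.end_missing wc.first (le_max_of_le_left (hmiss x).2)
    have app := moveColour_apply σ.nbr x (Y s) (Y (s + 1)) α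
    rw [wc.first, Nat.add_sub_cancel]
    refine rescan_vc (g := g) mv.colouring 8 fun c t hc hcl ht => ?_
    simp only [Function.update_apply, Nat.reduceEqDiff, if_true, if_false, e8, e6]
      at hc hcl ⊢
    have hs1 : ∀ i, s + 1 ≤ i → i ≤ k → Y i ≠ Y s := fun i h1 h2 e => by
      have := hfan.inj i s (by omega) h2 le_rfl (by omega) e
      omega
    have hmv : ∀ p, p ≠ x → p ≠ Y s →
        moveColour σ.nbr x (Y s) (Y (s + 1)) α p (ρ.miss p) = 0 := by
      intro p h1 h2
      rw [app, if_neg h2, if_neg h1, (wc.same p h1 h2 _).2 (hmiss p).1, ite_self, ite_self]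
    refine shift_vc (g := g) (Y := Y) (a := s + 1) (s := k) (k := k) ?_ ?_ ?_ ?_ ⟨?_, fun i j a1 a2 a3 a4 => hfan.inj i j (by omega) a2 (by omega) a4⟩ ?_ ?_
      (by omega) le_rfl ?_ ?_
    · exact mv.colouring
    · exact hde.trans hdeg
    · simp only [Function.update_apply, Nat.reduceEqDiff, if_true, if_false, e3]
      exact mv.hole
    · simp only [Function.update_apply, Nat.reduceEqDiff, if_false, e3]
      intro p hp
      by_cases hpy : p = Y s
      · rw [if_pos hpy, hpy]
        exact ⟨hc, hcl⟩
      · rw [if_neg hpy]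
        exact ⟨hmv p hp hpy, (hmiss p).2⟩
    · intro i h1 h2
      simp only [Function.update_apply, Nat.reduceEqDiff, if_false, e3]
      rw [if_neg (hs1 i h1 h2.le)]
      have hst := hfan.step i (by omega) h2
      -- The fan beyond `Y (s + 1)` survives the walk: its colours are present at `x`, hence not
      -- `α`, and `δ` belonged to the edge to `Y (s + 1)`.
      have n1 : ρ.miss (Y i) ≠ α := fun e => by rw [e] at hst; omega
      have n2 : ρ.miss (Y i) ≠ δ := fun e => by
        rw [e] at hst
        have := hfan.inj (i + 1) (s + 1) (by omega) (by omega) (by omega) (by omega) (by omega)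
        omega
      refine (app _ _).trans ?_
      rw [if_neg n1, wc.other _ _ n1 n2, hst]
    · simp
    · simp
    · simp only [Function.update_apply, Nat.reduceEqDiff, if_true, if_false]
      intro _
      rw [Nat.add_sub_cancel, if_neg hpy]
      refine ⟨(app _ _).trans ?_, fun e => ?_⟩
      · rw [if_pos rfl, if_neg hpy, if_neg hpx, if_pos rfl]
      · have h1 := (wc.same _ hpx hpy _).2 (hmiss (Y (s + 1))).1
        have h2 := wc.colouring.symm wc.first
        rw [show ρ.miss (Y (s + 1)) = α from e.symm] at h1
        omega
    · intro τ t' hsh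
      have r8 := hsh.reg 8 (by decide) (by decide) (by decide) (by decide)
      have rr := hsh.reg
      have hkeep := hsh.keep k (by omega) le_rfl
      have hcen := hsh.centre
      have hle := hsh.potential_le
      have htime := hsh.time
      have hcol := hsh.coloured
      have hpres := hsh.present δ
      have hho := hsh.hole
      have hms := hsh.missing
      simp only [Function.update_apply, Nat.reduceEqDiff, if_true, if_false, e3,
        if_neg (hs1 k (by omega) le_rfl)] at r8 hkeep hcen hle htime hcol hpres hho hms
      have hkx : Y k ≠ x := (g.ne hho.1).symm
      have p1 := wc.potential
      have p2 := mv.potential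
      rw [small_eq_one (hmiss (Y s)).2] at p1
      have s1 := small_le_one (g := g) (Y (s + 1)) α
      have hlt' := hfan.lt hf hhole.1
      have hpe : pending g (α + 1) (Y (s + 1)) = 1 - small g (Y (s + 1)) α := by
        rw [pending, if_neg (by omega), Nat.add_sub_cancel]
      change potential g (moveColour σ.nbr x (Y s) (Y (s + 1)) α) ≤ _ at hle
      change t' + 100 * (g.n + 1) * (potential g (moveColour σ.nbr x (Y s) (Y (s + 1)) α) + _) ≤ _
        at htime
      rw [hpe] at htime
      refine hQ _ _ ⟨hsh.low, hsh.deg, hsh.mark, ?_⟩ ⟨hsh.colouring, ?_, ?_, ?_, ?_, ?_, ?_, ?_⟩ ?_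
      · intro i a1 a2 a3 a4 a5
        rw [rr i a1 a2 a4 a5]
        simp [a1, a2, a3, a4, a5]
      · rw [r8]; exact hho
      · rw [hpres]
        refine (app _ _).trans ?_
        rw [if_neg hαδ.symm, wc.start]
      · rw [r8]
        have := (hms (Y k) hkx).1
        rwa [hkeep, ← hst] at this
      · rw [r8, hst]
        exact (hmiss _).2
      · intro p a1 _ _ _
        exact hms p a1
      · left
        refine ⟨o5, ?_⟩
        rw [r8]
        refine (Set.insert_subset_insert wc.coloured).trans (mv.coloured.trans ?_)
        exact hcol
      · omega
      -- The path ends with `δ` gained at `Y s`, where it is small; this gives the second unit. One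
      -- of the two units covers `small g (Y (s + 1)) α` together with the initial `pending` term,
      -- whose sum is `1`.
      · have e1 : potential g (moveColour σ.nbr x (Y s) (Y (s + 1)) α) + small g (Y (s + 1)) α +
          small g x δ = potential g f₁ + 2 := by omega
        obtain ⟨z, hz, hz'⟩ : ∃ z, 1 - small g (Y (s + 1)) α = z ∧ small g (Y (s + 1)) α + z = 1 :=
          ⟨_, rfl, by omega⟩
        rw [hz] at htime
        have E1 := congrArg (fun q => 100 * (g.n + 1) * q) e1
        have E2 := congrArg (fun q => 100 * (g.n + 1) * q) hz'
        simp only [mul_add] at E1 E2 htime ⊢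
        omega
  · have hou : (σ.r 5 = 0 ∧ insert s(x, Y s) (coloured f₁) ⊆
          insert s(x, σ.r 8) (coloured σ.nbr)) ∨
        (σ.r 5 = 1 ∧ Hole g σ.nbr (σ.r 11) (σ.r 12) ∧ (σ.r 11 = x → σ.r 12 ≠ σ.r 8) ∧
          σ.r 12 ≠ x ∧ insert s(x, Y s) (coloured f₁) ⊆
            insert s(σ.r 11, σ.r 12) (insert s(x, σ.r 8) (coloured σ.nbr))) := by
      rw [e8]
      obtain ⟨o5, a, b, wc⟩ | ⟨o5, a, b, X, hb, wk⟩ := hout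
      · exact Or.inl ⟨o5, Set.insert_subset_insert wc.coloured⟩
      · refine Or.inr ⟨o5, wk.hole, fun e => ?_, wk.right_ne, ?_⟩
        · rw [(wk.first e).1]; exact hpy
        · rw [Set.insert_comm]
          exact Set.insert_subset_insert wk.coloured
    have hall : PartialColouring g σ.nbr ∧ σ.nbr x δ = 0 ∧ (σ.nbr x α = 0 ∨
        σ.nbr x α = Y (s + 1) + 1) ∧ (∀ q c, c ≠ α → c ≠ δ → σ.nbr q c = f₁ q c) ∧
        (∀ q, q ≠ x → q ≠ σ.r 11 → q ≠ σ.r 12 → ∀ c, σ.nbr q c = 0 ↔ f₁ q c = 0) ∧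
        potential g f₁ ≤ potential g σ.nbr + small g x δ := by
      obtain ⟨o5, a, b, wc⟩ | ⟨o5, a, b, X, hb, wk⟩ := hout
      · have p1 := wc.potential
        have := small_le_one (g := g) (σ.r 12) b
        exact ⟨wc.colouring, wc.start, Or.inr wc.first, wc.other,
          fun q h1 _ h2 => wc.same q h1 h2, by omega⟩
      · have p1 := wk.potential
        have := small_le_one (g := g) (σ.r 11) a
        rw [small_eq_zero hb] at p1
        refine ⟨wk.colouring, wk.start, ?_, wk.other, wk.same, by omega⟩
        by_cases hu : σ.r 11 = x
        · left
          have := wk.missing_left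
          rwa [(wk.first hu).2.1, hu] at this
        · exact Or.inr (wk.later hu)
    obtain ⟨q1, q2, q3, q4, q5, q6⟩ := hall
    refine hQ _ _ ⟨rfl, rfl, rfl, fun _ _ _ _ _ _ => rfl⟩
      ⟨q1, ⟨by rw [e8]; exact hhole.1, fun c e => ?_⟩, q2, by rw [e8]; exact hret,
        by rw [e8]; exact (hmiss _).2, fun p a1 a2 a3 _ => ?_, hou, q6⟩ ?_
    · rw [e8] at e
      by_cases h1 : c = α
      · rw [h1] at e; omega
      by_cases h2 : c = δ
      · rw [h2] at e; omega
      rw [q4 x c h1 h2] at e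
      exact hhole.2 c e
    · rw [hmi]
      exact ⟨(q5 p a1 a2 a3 _).2 (hmiss p).1, (hmiss p).2⟩
    · have := Nat.mul_le_mul_left (100 * (g.n + 1)) q6
      omega

/-! ### One step raises the potential -/

/-- The data structures of the algorithm are consistent. -/
structure Consistent (g : Host) (σ : Store) : Prop where
  colouring : PartialColouring g σ.nbr
  deg : σ.deg = g.d
  missing : ∀ p, σ.nbr p (σ.miss p) = 0 ∧ σ.miss p ≤ g.d p
  mark : ∀ v, σ.mark v ≤ σ.r 16

/-- The outcome of `step`. -/
structure Stepped (g : Host) (σ τ : Store) (t : ℕ) : Prop where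
  consistent : Consistent g τ
  low : τ.low = σ.low
  reg : ∀ i < 3, τ.r i = σ.r i
  outcome : (τ.r 5 = 0 ∧ insert s(σ.r 3, σ.r 4) (coloured σ.nbr) ⊆ coloured τ.nbr) ∨
    (τ.r 5 = 1 ∧ Hole g τ.nbr (τ.r 3) (τ.r 4) ∧
      insert s(σ.r 3, σ.r 4) (coloured σ.nbr) ⊆ insert s(τ.r 3, τ.r 4) (coloured τ.nbr))
  potential_lt : potential g σ.nbr < potential g τ.nbr
  time : t + 4000 * (g.n + 1) * potential g σ.nbr ≤ 4000 * (g.n + 1) * potential g τ.nbr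

/-- Neither the shift nor the walk loses more potential than `small g x c`, where `c` is the closing
colour. Closing returns this amount and adds `1`, because `c` is small at the other end. This net
unit pays for all `O(n)` work outside the amortised shifts. -/
theorem step_vc {σ : Store} (hσ : Consistent g σ) (hh : Hole g σ.nbr (σ.r 3) (σ.r 4))
    (h5 : σ.r 5 = 1) {Q : Store → ℕ → Prop} (hQ : ∀ τ t, Stepped g σ τ t → Q τ t) :
    step.vc σ Q := by
  simp only [step, Cmd.vc, AExpr.eval, AExpr.cost, Op.eval]
  refine ⟨by decide, explore_vc (g := g) ?_ ?_ ?_ ?_⟩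
  · exact hσ.colouring
  · simpa using hh
  -- Register `16` is a fresh time stamp, so old marks need not be erased.
  · intro v
    have := hσ.mark v
    simp only [Function.update_self]
    omega
  intro τ t₁ Y k s hex ht₁
  have hreg := hex.reg
  have hmark := hex.mark
  have hzero := hex.zero
  have hfan := hex.fan
  have hlast := hex.exit
  simp only [Function.update_apply, Nat.reduceEqDiff, if_true, if_false] at hmark hzero hfan hlast
  have r3 : τ.r 3 = σ.r 3 := hreg 3 (by decide) (by decide) (by decide) (by decide) (by decide)
  have r4 : τ.r 4 = σ.r 4 := hreg 4 (by decide) (by decide) (by decide) (by decide) (by decide)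
  have r5 : τ.r 5 = σ.r 5 := hreg 5 (by decide) (by decide) (by decide) (by decide) (by decide)
  have r16 : τ.r 16 = σ.r 16 + 1 := by
    rw [hreg 16 (by decide) (by decide) (by decide) (by decide) (by decide)]; simp
  have rlow : ∀ i < 3, τ.r i = σ.r i := fun i hi => by
    rw [hreg i (by omega) (by omega) (by omega) (by omega) (by omega)]
    exact Function.update_of_ne (by omega) _ _
  have tn : τ.nbr = σ.nbr := hex.nbr
  have tm : τ.miss = σ.miss := hex.miss
  have td : τ.deg = g.d := hex.deg.trans hσ.deg
  have tl : τ.low = σ.low := hex.low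
  rw [← tn] at hfan hlast
  rw [← tm] at hfan hlast
  rw [← r3] at hfan hlast
  have hk := hex.le
  have hlt := hfan.lt (g := g) (tn ▸ hσ.colouring) (by rw [r3, hzero]; exact hh.1)
  refine ⟨by decide, shift_vc (g := g) (Y := Y) (a := 0) (s := s) (k := k) ?_ ?_ ?_ ?_ ?_ ?_ ?_
    (Nat.zero_le _) hk ?_ ?_⟩
  · rw [tn]; exact hσ.colouring
  · exact td
  · simpa [tn, r3, r4] using hh
  · intro p _
    rw [tn, tm]; exact hσ.missing p
  · simpa using hfan
  · simpa [hzero] using r4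
  · simpa using hex.target
  · intro hc
    simp at hc
  intro ν t₂ hsh
  have sreg := hsh.reg
  have snbr := hsh.colouring
  have shole := hsh.hole
  have smiss := hsh.missing
  have scen := hsh.centre
  have sfan := hsh.fan
  have skeep := hsh.keep
  have spres := hsh.present
  have scol := hsh.coloured
  have spot := hsh.potential_le
  have stime := hsh.time
  simp only [Function.update_apply, Nat.reduceEqDiff, if_true, if_false, tn, tm, r3, r4]
    at shole smiss scen sfan skeep spres scol spot stime
  have n3 : ν.r 3 = σ.r 3 := by
    rw [sreg 3 (by decide) (by decide) (by decide) (by decide)]; simpa using r3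
  have n5 : ν.r 5 = 1 := by
    rw [sreg 5 (by decide) (by decide) (by decide) (by decide)]; simpa [h5] using r5
  have n6 : ν.r 6 = Y k := by
    rw [sreg 6 (by decide) (by decide) (by decide) (by decide)]; simpa using hex.last
  have n8 : ν.r 8 = Y s := by
    rw [sreg 8 (by decide) (by decide) (by decide) (by decide)]; simpa using hex.target
  have n16 : ν.r 16 = σ.r 16 + 1 := by
    rw [sreg 16 (by decide) (by decide) (by decide) (by decide)]; simpa using r16
  have nlow : ∀ i < 3, ν.r i = σ.r i := fun i hi => by
    rw [sreg i (by omega) (by omega) (by omega) (by omega)]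
    simpa [show i ≠ 9 by omega] using rlow i hi
  have nl : ν.low = σ.low := hsh.low.trans tl
  have nd : ν.deg = g.d := hsh.deg.trans td
  have nm : ∀ v, ν.mark v ≤ σ.r 16 + 1 := fun v => by rw [hsh.mark]; exact hmark v
  have nmiss : ∀ p, ν.nbr p (ν.miss p) = 0 ∧ ν.miss p ≤ g.d p := by
    intro p
    by_cases hp : p = σ.r 3
    · rw [hp, scen, spres]
      exact hσ.missing _
    · exact smiss p hp
  have npend : pending g 0 (σ.r 4) = 1 := rfl
  rw [npend] at stime
  -- Common end of both branches: `3000 * (n + 1)` is the allowance for work not yet charged to the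
  -- potential.
  have hfin : ∀ (ω : Store) (t : ℕ), ω.low = σ.low → ω.deg = g.d →
      (∀ v, ω.mark v ≤ ω.r 16) → (∀ i < 3, ω.r i = σ.r i) → ω.r 3 = σ.r 3 →
      Ready g ν.nbr (σ.r 3) (Y s) (ω.r 10) (ω.r 11) (ω.r 12) (ω.r 5) ω →
      t + 100 * (g.n + 1) * potential g σ.nbr ≤ 3000 * (g.n + 1) +
        100 * (g.n + 1) * (potential g ω.nbr + small g (σ.r 3) (ω.r 10) + 1) →
      ∀ P : Store → ℕ → Prop, (∀ τ t', Stepped g σ τ (t + t') → P τ t') → finish.vc ω P := by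
    intro ω t o1 o2 o3 o4 o5 hr ht P hP
    refine finish_vc hr o5 rfl rfl rfl rfl fun τ t' hf ht' => hP τ t' ?_
    refine ⟨⟨hf.colouring, hf.deg.trans o2, hf.missing, fun v => ?_⟩, hf.low.trans o1,
      fun i hi => ?_, ?_, ?_, ?_⟩
    · rw [hf.mark, hf.reg 16 (by decide) (by decide)]; exact o3 v
    · rw [hf.reg i (by omega) (by omega)]; exact o4 i hi
    · rcases hf.outcome with ⟨a1, a2⟩ | ⟨a1, a2, a3⟩
      · exact Or.inl ⟨a1, scol.trans a2⟩
      · exact Or.inr ⟨a1, a2, scol.trans a3⟩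
    · have := hr.potential
      have := hf.potential
      omega
    · have e1 := hr.potential
      have e2 := hf.potential
      -- As the gain is at least `1`, the fixed costs `(3000 + 600) * (n + 1)` are absorbed by the
      -- factor `4000`.
      obtain ⟨q, hq⟩ : ∃ q, potential g τ.nbr = potential g σ.nbr + 1 + q :=
        ⟨potential g τ.nbr - potential g σ.nbr - 1, by omega⟩
      rw [← e2, hq] at ht
      rw [hq]
      nlinarith [Nat.zero_le (g.n * q)]
  simp only [Function.update_apply, Nat.reduceEqDiff, if_true, if_false, ne_eq, n8, n3,
    OfNat.ofNat_ne_one, not_false_eq_true, true_and, unlinkCmd, Cmd.vc, AExpr.eval, AExpr.cost]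
  refine ⟨fun hw => ?_, fun hw => ?_⟩
  · have hsk : s < k ∧ τ.miss (Y s) = τ.miss (Y k) := by
      rcases hlast with ⟨rfl, h⟩ | h
      · exfalso
        apply hw
        rw [spres, skeep s le_rfl le_rfl, ← tm, ← tn, ← r3]
        exact h
      · exact h
    obtain ⟨hsk, hst⟩ := hsk
    rw [tm, ← skeep s le_rfl hk, ← skeep k hk le_rfl] at hst
    have hx := sfan.step s le_rfl hsk
    rw [hx, Nat.add_sub_cancel]
    have hne : ν.miss (σ.r 3) ≠ ν.miss (Y s) := by
      intro e
      have := (nmiss (σ.r 3)).1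
      rw [e, hx] at this
      omega
    have hw0 := Walk.init snbr (nmiss (σ.r 3)).1 (nmiss (σ.r 3)).2 hx
    refine walk_vc (g := g) (f₁ := ν.nbr) (p := Y (s + 1)) (X := {σ.r 3, Y (s + 1)}) ?_ ?_ ?_ ?_ ?_
    · exact nd
    · simp only [Function.update_apply, Nat.reduceEqDiff, if_true, if_false, n3]
      exact hw0
    · simpa using hne
    · simp
    intro ω t₃ hwe ht₃
    have wreg := hwe.reg
    have w3 := wreg 3 (by decide) (by decide) (by decide) (by decide) (by decide) (by decide)
      (by decide) (by decide)
    have w16 := wreg 16 (by decide) (by decide) (by decide) (by decide) (by decide) (by decide)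
      (by decide) (by decide)
    have w18 := wreg 18 (by decide) (by decide) (by decide) (by decide) (by decide) (by decide)
      (by decide) (by decide)
    have wlow : ∀ i < 3, ω.r i = σ.r i := fun i hi => by
      rw [wreg i (by omega) (by omega) (by omega) (by omega) (by omega) (by omega) (by omega)
        (by omega)]
      simpa [Function.update_apply, show i ≠ 7 by omega, show i ≠ 10 by omega,
        show i ≠ 11 by omega, show i ≠ 12 by omega, show i ≠ 13 by omega, show i ≠ 14 by omega,
        show i ≠ 15 by omega, show i ≠ 18 by omega] using nlow i hi
    simp only [Function.update_apply, Nat.reduceEqDiff, if_true, if_false, n3, n16] at w3 w16 w18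
    refine turn_vc (g := g) (f₁ := ν.nbr) (Y := Y) (s := s) (k := k) snbr hsk ?_ ?_ ?_ ?_ ?_ ?_ ?_
      ?_ ?_ ?_ ?_ hwe ?_
    · simpa [n3] using sfan
    · simpa [n3] using shole
    · exact nmiss
    · exact hst
    · exact nd
    · simp [n3]
    · simp
    · simp
    · simpa using n8
    · simpa using n6
    · simpa using n5
    intro ζ t₄ hfr hrd ht₄
    have z3 := hfr.reg 3 (by decide) (by decide) (by decide) (by decide) (by decide)
    have z5 := hfr.reg 5 (by decide) (by decide) (by decide) (by decide) (by decide)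
    have z11 := hfr.reg 11 (by decide) (by decide) (by decide) (by decide) (by decide)
    have z12 := hfr.reg 12 (by decide) (by decide) (by decide) (by decide) (by decide)
    have z16 := hfr.reg 16 (by decide) (by decide) (by decide) (by decide) (by decide)
    have z18 := hfr.reg 18 (by decide) (by decide) (by decide) (by decide) (by decide)
    simp only [Function.update_apply, Nat.reduceEqDiff, if_false, n3] at hrd ht₄
    rw [z18, w18]
    refine hfin _ (t₁ + t₂ + t₃ + t₄ + 400) ?_ ?_ ?_ ?_ ?_ ?_ ?_ _
      (fun τ' t' h => hQ τ' _ ?_)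
    rotate_left 7
    · refine ⟨h.consistent, h.low, h.reg, h.outcome, h.potential_lt, le_trans ?_ h.time⟩
      omega
    · exact hfr.low.trans (hwe.low.trans nl)
    · exact hfr.deg.trans (hwe.deg.trans nd)
    · intro v
      simp only [Function.update_apply, Nat.reduceEqDiff, if_false]
      rw [hfr.mark, hwe.mark, z16, w16]
      exact nm v
    · intro i hi
      simp only [Function.update_apply, show i ≠ 10 by omega, if_false]
      rw [hfr.reg i (by omega) (by omega) (by omega) (by omega) (by omega)]
      exact wlow i hi
    · simp only [Function.update_apply, Nat.reduceEqDiff, if_false]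
      rw [z3, w3]
    · simp only [Function.update_apply, Nat.reduceEqDiff, if_true, if_false, z5, z11, z12]
      exact ⟨hrd.colouring, hrd.hole, hrd.centre, hrd.leaf, hrd.le, hrd.missing, hrd.outcome,
        hrd.potential⟩
    · simp only [Function.update_apply, if_true]
      simp only [mul_add] at stime ht₄ ⊢
      omega
  · refine hfin _ (t₁ + t₂ + 200)
      ?_ ?_ ?_ ?_ ?_ ?_ ?_ _
      (fun τ' t' h => hQ τ' _ ?_)
    rotate_left 7
    · refine ⟨h.consistent, h.low, h.reg, h.outcome, h.potential_lt, le_trans ?_ h.time⟩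
      omega
    · exact nl
    · exact nd
    · intro v
      simp only [Function.update_apply, Nat.reduceEqDiff, if_false]
      rw [n16]
      exact nm v
    · intro i hi
      simp only [Function.update_apply, show i ≠ 10 by omega, show i ≠ 5 by omega,
        show i ≠ 7 by omega, show i ≠ 11 by omega, show i ≠ 12 by omega, if_false]
      exact nlow i hi
    · simpa [Function.update_apply] using n3
    · simp only [Function.update_apply, Nat.reduceEqDiff, if_true, if_false]
      refine ⟨snbr, ?_, hw, ?_, ?_, fun p _ _ _ _ => nmiss p, Or.inl ⟨rfl, ?_⟩,
        Nat.le_add_right _ _⟩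
      · simpa [n8] using shole
      · simpa [n8] using (nmiss (Y s)).1
      · simpa [n8] using (nmiss (Y s)).2
      · simp [n8]
    · simp only [Function.update_apply, Nat.reduceEqDiff, if_true, if_false]
      simp only [mul_add] at stime ⊢
      omega

/-! ### Edge lists and the whole program -/

/-- A list of `m` different edges `E i F i` on the vertices `0, …, n - 1`. -/
structure EdgeData where
  n : ℕ
  m : ℕ
  E : ℕ → ℕ
  F : ℕ → ℕ
  E_lt : ∀ i < m, E i < n
  F_lt : ∀ i < m, F i < n
  ne : ∀ i < m, E i ≠ F i
  inj : ∀ i < m, ∀ j < m, s(E i, F i) = s(E j, F j) → i = j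

namespace EdgeData

variable (D : EdgeData)

/-- The number of the first `j` edges at the vertex `v`. -/
def count (j v : ℕ) : ℕ :=
  ∑ i ∈ Finset.range j, ((if E D i = v then 1 else 0) + if F D i = v then 1 else 0)

/-- The graph of the first `j` edges, with the degrees of the graph of all edges. -/
def host (hd : ∀ v, D.count D.m v ≤ D.n) (j : ℕ) : Host where
  n := D.n
  Adj u v := ∃ i < D.m, i < j ∧ s(u, v) = s(D.E i, D.F i)
  d := D.count D.m
  symm := by
    rintro u v ⟨i, h1, h2, h⟩
    exact ⟨i, h1, h2, by rw [Sym2.eq_swap]; exact h⟩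
  irrefl := by
    rintro v ⟨i, h1, h2, h⟩
    rw [Sym2.eq_iff] at h
    have := D.ne i h1
    omega
  lt := by
    rintro u v ⟨i, h1, h2, h⟩
    have := D.E_lt i h1
    have := D.F_lt i h1
    rw [Sym2.eq_iff] at h
    omega
  card_le := by
    intro v s hs
    -- Choosing for each neighbour the index of its edge is injective, and every chosen index
    -- contributes to `count` at `v`.
    choose! f hf1 _ hf2 using hs
    have hinj : (s.image f).card = s.card := by
      refine Finset.card_image_of_injOn fun u hu u' hu' e => ?_
      have h1 := hf2 u hu
      rw [e, ← hf2 u' hu'] at h1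
      exact Sym2.congr_right.1 h1
    rw [← hinj]
    have hsub : s.image f ⊆ Finset.range D.m := by
      intro i hi
      obtain ⟨u, hu, rfl⟩ := Finset.mem_image.1 hi
      exact Finset.mem_range.2 (hf1 u hu)
    rw [Finset.card_eq_sum_ones]
    refine (Finset.sum_le_sum fun i hi => ?_).trans (Finset.sum_le_sum_of_subset hsub)
    obtain ⟨u, hu, rfl⟩ := Finset.mem_image.1 hi
    have := hf2 u hu
    rw [Sym2.eq_iff] at this
    rcases this with ⟨h, -⟩ | ⟨h, -⟩ <;> simp [← h]
  d_le := hd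

end EdgeData

variable (D : EdgeData)

/-- The edges are in the memory. -/
structure HasInput (D : EdgeData) (σ : Store) : Prop where
  edges : σ.r 1 = D.m
  fst : ∀ i < D.m, σ.low (i + i) = D.E i
  snd : ∀ i < D.m, σ.low (i + i + 1) = D.F i

theorem countDegrees_vc {σ : Store} (hin : HasInput D σ) (h0 : ∀ v, σ.deg v = 0)
    {Q : Store → ℕ → Prop}
    (hQ : ∀ τ t, τ.low = σ.low → τ.r 1 = σ.r 1 → τ.deg = D.count D.m →
      τ.miss = σ.miss → τ.mark = σ.mark → τ.nbr = σ.nbr → t ≤ 200 * (D.m + 1) → Q τ t) :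
    countDegrees.vc σ Q := by
  simp only [countDegrees, Cmd.vc, AExpr.eval, AExpr.cost]
  refine ⟨by decide, ?_⟩
  refine (Cmd.runs_loop (fun idx τ t => ∃ j, idx + j = D.m ∧ t ≤ 100 * j ∧ τ.r 2 = j ∧
    τ.low = σ.low ∧ τ.r 1 = D.m ∧ τ.deg = D.count j ∧
      τ.miss = σ.miss ∧ τ.mark = σ.mark ∧ τ.nbr = σ.nbr) ?_ (i := D.m) ?_).mono ?_
  · rintro idx τ t ⟨j, h1, h2, h3, h4, h5, h7, h8, h9, h10⟩ he P hP
    have hj : j < D.m := by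
      by_contra hc
      simp [AExpr.eval, Op.eval, h3, h5, hc] at he
    have hE := hin.fst j hj
    have hF := hin.snd j hj
    simp only [AExpr.cost] at hP
    simp only [Cmd.vc, AExpr.eval, AExpr.cost, Op.eval, Function.update_apply, ne_eq,
      OfNat.ofNat_ne_one, not_false_eq_true, true_and, Nat.reduceEqDiff, if_true, if_false, h3, h5,
      h4, if_pos (show j + j < 3 * D.m by omega), if_pos (show j + j + 1 < 3 * D.m by omega), hE,
      hF, OfNat.one_ne_ofNat]
    refine hP _ _ (idx - 1) (by omega) ⟨j + 1, by omega, by omega, by simp, rfl, by simpa using h5,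
      ?_, h8, h9, h10⟩
    funext v
    have hne := D.ne j hj
    simp only [Function.update_apply, EdgeData.count, Finset.sum_range_succ, h7]
    by_cases e1 : v = D.F j
    · subst e1
      simp [hne, hne.symm]
    · by_cases e2 : v = D.E j
      · subst e2
        simp [hne, hne.symm]
      · simp [e1, e2, Ne.symm e1, Ne.symm e2]
  · refine ⟨0, by omega, by omega, by simp, rfl, by simpa using hin.edges, ?_, rfl, rfl, rfl⟩
    funext v
    simp [EdgeData.count, h0]
  · rintro τ _ ⟨idx, t, ⟨j, h1, h2, h3, h4, h5, h7, h8, h9, h10⟩, he, rfl⟩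
    have hj : j = D.m := by
      by_contra hc
      simp [AExpr.eval, Op.eval, h3, h5, show j < D.m by omega] at he
    subst hj
    exact hQ τ _ h4 (h5.trans hin.edges.symm) h7 h8 h9 h10 (by simp only [AExpr.cost]; omega)

variable {D}

theorem PartialColouring.mono {hd : ∀ v, D.count D.m v ≤ D.n} {f : ℕ → ℕ → ℕ} {i j : ℕ}
    (hij : i ≤ j) (h : PartialColouring (D.host hd i) f) : PartialColouring (D.host hd j) f := by
  refine ⟨fun e => ?_, h.symm, h.le, h.inj⟩
  obtain ⟨l, h1, h2, h3⟩ := h.adj e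
  exact ⟨l, h1, by omega, h3⟩

theorem colourEdges_vc {σ : Store} (hd : ∀ v, D.count D.m v ≤ D.n) (hin : HasInput D σ)
    (hdeg : σ.deg = D.count D.m) (hmiss : ∀ v, σ.miss v = 0) (hmark : ∀ v, σ.mark v = 0)
    (hnbr : ∀ v c, σ.nbr v c = 0) {Q : Store → ℕ → Prop}
    (hQ : ∀ τ t, τ.low = σ.low → τ.r 1 = σ.r 1 → PartialColouring (D.host hd D.m) τ.nbr →
      (∀ i < D.m, s(D.E i, D.F i) ∈ coloured τ.nbr) →
      t ≤ 4001 * (D.n + 1) * potential (D.host hd D.m) τ.nbr + 100 * (D.m + 1) → Q τ t) :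
    colourEdges.vc σ Q := by
  simp only [colourEdges, Cmd.vc, AExpr.eval, AExpr.cost]
  refine ⟨by decide, ?_⟩
  refine (Cmd.runs_loop (fun idx τ t => ∃ j, idx + j = D.m ∧ τ.r 2 = j ∧ τ.low = σ.low ∧
    τ.r 1 = D.m ∧ Consistent (D.host hd j) τ ∧ (∀ i < j, s(D.E i, D.F i) ∈ coloured τ.nbr) ∧
    t ≤ 4001 * (D.n + 1) * potential (D.host hd D.m) τ.nbr + 100 * j)
    ?_ (i := D.m) ?_).mono ?_
  · rintro idx τ t ⟨j, h1, h2, h3, h4, h5, h6, h7⟩ he P hP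
    have hj : j < D.m := by
      by_contra hc
      simp [AExpr.eval, Op.eval, h2, h4, hc] at he
    have hE := hin.fst j hj
    have hF := hin.snd j hj
    simp only [AExpr.cost] at hP
    simp only [Cmd.vc, AExpr.eval, AExpr.cost, Op.eval, Function.update_apply, ne_eq,
      OfNat.ofNat_ne_one, not_false_eq_true, true_and, Nat.reduceEqDiff, if_false, h2, h4,
      h3, if_pos (show j + j < 3 * D.m by omega), if_pos (show j + j + 1 < 3 * D.m by omega), hE,
      hF, OfNat.one_ne_ofNat]
    -- All these hosts have the same degrees, so the potential is the same function throughout and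
    -- only adjacency grows with `j`.
    set g := D.host hd (j + 1)
    have hh : Hole g τ.nbr (D.E j) (D.F j) := by
      refine ⟨⟨j, hj, by omega, rfl⟩, fun c e => ?_⟩
      obtain ⟨i, a1, a2, a3⟩ := h5.colouring.adj e
      have := D.inj j hj i a1 a3
      omega
    have hc0 : Consistent g τ := ⟨h5.colouring.mono (by omega), h5.deg, h5.missing, h5.mark⟩
    -- The distance of the potential from the degree sum is the loop measure. The factor `4001`
    -- instead of `4000` pays for the loop tests, as every step gains at least one unit and `n ≥ 1`.
    refine (Cmd.runs_loop (fun k ω t' => (ω.low = σ.low ∧ ω.r 1 = D.m ∧ ω.r 2 = j ∧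
      Consistent g ω) ∧ k + potential g ω.nbr = ∑ v ∈ Finset.range g.n, g.d v ∧
      t' + 4001 * (D.n + 1) * potential g τ.nbr ≤ 4001 * (D.n + 1) * potential g ω.nbr ∧
      ((ω.r 5 = 0 ∧ ∀ i < j + 1, s(D.E i, D.F i) ∈ coloured ω.nbr) ∨
       (ω.r 5 = 1 ∧ Hole g ω.nbr (ω.r 3) (ω.r 4) ∧
        ∀ i < j + 1, s(D.E i, D.F i) ∈ insert s(ω.r 3, ω.r 4) (coloured ω.nbr))))
      ?_ (i := ∑ v ∈ Finset.range g.n, g.d v - potential g τ.nbr) ?_).mono ?_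
    · rintro k ω t' ⟨⟨w1, w2, w3, w4⟩, w5, w6, w7⟩ he P' hP'
      obtain ⟨w8, -⟩ | ⟨w8, w9, w10⟩ := w7
      · exact absurd w8 he
      refine step_vc w4 w9 w8 fun ω' t'' hs => ?_
      have hle := hs.consistent.colouring.potential_le
      have hlt := hs.potential_lt
      have htime := hs.time
      refine hP' _ _ (∑ v ∈ Finset.range g.n, g.d v - potential g ω'.nbr) (by omega)
        ⟨⟨hs.low.trans w1, (hs.reg 1 (by decide)).trans w2, (hs.reg 2 (by decide)).trans w3,
          hs.consistent⟩, by omega, ?_, ?_⟩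
      · change t'' + 4000 * (D.n + 1) * _ ≤ 4000 * (D.n + 1) * _ at htime
        simp only [AExpr.cost]
        obtain ⟨q, hq⟩ : ∃ q, potential g ω'.nbr = potential g ω.nbr + 1 + q :=
          ⟨potential g ω'.nbr - potential g ω.nbr - 1, by omega⟩
        have hn : 1 ≤ D.n := by have := D.E_lt j hj; omega
        rw [hq] at htime ⊢
        nlinarith
      · rcases hs.outcome with ⟨o1, o2⟩ | ⟨o1, o2, o3⟩
        · exact Or.inl ⟨o1, fun i hi => o2 (w10 i hi)⟩
        · exact Or.inr ⟨o1, o2, fun i hi => o3 (w10 i hi)⟩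
    · have hle := hc0.colouring.potential_le
      refine ⟨⟨h3 ▸ rfl, by simpa using h4, by simpa using h2,
        ⟨hc0.colouring, hc0.deg, hc0.missing, by simpa using hc0.mark⟩⟩, Nat.sub_add_cancel hle, by simp,
        Or.inr ⟨by simp, by simpa using hh, ?_⟩⟩
      intro i hi
      rcases Nat.lt_succ_iff_lt_or_eq.1 hi with hi | rfl
      · exact Or.inr (h6 i hi)
      · exact Or.inl (by simp)
    · rintro ω _ ⟨k, t', ⟨⟨w1, w2, w3, w4⟩, w5, w6, w7⟩, he, rfl⟩
      obtain ⟨-, w9⟩ | ⟨w8, -⟩ := w7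
      swap
      · simp [AExpr.eval, w8] at he
      change _ + 4001 * (D.n + 1) * potential (D.host hd D.m) τ.nbr ≤
        4001 * (D.n + 1) * potential (D.host hd D.m) ω.nbr at w6
      refine hP _ _ (idx - 1) (by omega) ⟨j + 1, by omega, by simp [w3], w1, by simpa using w2,
        ⟨w4.colouring, w4.deg, w4.missing, by simpa using w4.mark⟩, w9, ?_⟩
      simp only [AExpr.cost]
      omega
  · refine ⟨0, by omega, by simp, rfl, by simpa using hin.edges, ⟨⟨?_, ?_, ?_, ?_⟩, hdeg, ?_, ?_⟩,
      by omega, by omega⟩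
    · intro v c w e
      rw [hnbr] at e; omega
    · intro v c w e
      rw [hnbr] at e; omega
    · intro v c w e
      rw [hnbr] at e; omega
    · intro v c c' w e
      rw [hnbr] at e; omega
    · exact fun p => ⟨hnbr _ _, by simp [hmiss]⟩
    · intro v
      simp [hmark]
  · rintro τ _ ⟨idx, t, ⟨j, h1, h2, h3, h4, h5, h6, h7⟩, he, rfl⟩
    have hj : j = D.m := by
      by_contra hc
      simp [AExpr.eval, Op.eval, h2, h4, show j < D.m by omega] at he
    subst hj
    exact hQ τ _ h3 (h4.trans hin.edges.symm) h5.colouring h6 (by simp only [AExpr.cost]; omega)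

/-- The colour of an edge is at most `n`, so a linear search in its table row costs `O(n)`. The
output cells lie behind the first `2 * m` cells, which keeps the edges still to be read intact. -/
theorem writeColours_vc {σ : Store} (hd : ∀ v, D.count D.m v ≤ D.n) (hin : HasInput D σ)
    (hf : PartialColouring (D.host hd D.m) σ.nbr)
    (hcol : ∀ i < D.m, s(D.E i, D.F i) ∈ coloured σ.nbr) {Q : Store → ℕ → Prop}
    (hQ : ∀ τ t, τ.nbr = σ.nbr → τ.r 1 = D.m →
      (∀ i < D.m, ∃ c, σ.nbr (D.E i) c = D.F i + 1 ∧ τ.low (D.m + D.m + i) = c + 1) →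
      t ≤ 150 * (D.n + 1) * D.m + 100 → Q τ t) :
    writeColours.vc σ Q := by
  simp only [writeColours, Cmd.vc, AExpr.eval, AExpr.cost]
  refine ⟨by decide, ?_⟩
  refine (Cmd.runs_loop (fun idx τ t => ∃ j, idx + j = D.m ∧ τ.r 2 = j ∧ HasInput D τ ∧
    τ.nbr = σ.nbr ∧ t ≤ 150 * (D.n + 1) * j ∧
    (∀ i < j, ∃ c, σ.nbr (D.E i) c = D.F i + 1 ∧ τ.low (D.m + D.m + i) = c + 1))
    ?_ (i := D.m) ?_).mono ?_
  · rintro idx τ t ⟨j, h1, h2, h3, h4, h5, h6⟩ he P hP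
    have hm := h3.edges
    have hj : j < D.m := by
      by_contra hc
      simp [AExpr.eval, Op.eval, h2, hm, hc] at he
    have hE := h3.fst j hj
    have hF := h3.snd j hj
    obtain ⟨c, hc⟩ : ∃ c, σ.nbr (D.E j) c = D.F j + 1 := by
      obtain ⟨u, v, c, e1, e2⟩ := hcol j hj
      rw [Sym2.eq_iff] at e2
      rcases e2 with ⟨e3, e4⟩ | ⟨e3, e4⟩
      · exact ⟨c, by rw [e3, e4, e1]⟩
      · exact ⟨c, by rw [e3, e4, hf.symm e1]⟩
    have hcn : c ≤ D.n := (hf.le hc).trans (max_le (hd _) (hd _))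
    simp only [AExpr.cost] at hP
    simp only [Cmd.vc, AExpr.eval, AExpr.cost, Op.eval, Function.update_apply, ne_eq,
      OfNat.ofNat_ne_one, not_false_eq_true, true_and, Nat.reduceEqDiff, if_false, h2, hm,
      if_pos (show j + j < 3 * D.m by omega), if_pos (show j + j + 1 < 3 * D.m by omega), hE,
      hF, OfNat.one_ne_ofNat]
    refine (Cmd.runs_loop (fun k ω t' => ∃ q, k + q = c ∧ ω.r 10 = q ∧ ω.r 1 = D.m ∧ ω.r 2 = j ∧
      ω.r 3 = D.E j ∧ ω.r 4 = D.F j ∧ ω.nbr = σ.nbr ∧ ω.low = τ.low ∧ t' ≤ 50 * q)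
      ?_ (i := c) ?_).mono ?_
    · rintro k ω t' ⟨q, w1, w2, w3, w4, w5, w6, w7, w8, w9⟩ he P' hP'
      have hq : q < c := by
        by_contra hq
        obtain rfl : q = c := by omega
        simp [AExpr.eval, Op.eval, w2, w5, w6, w7, hc] at he
      simp only [AExpr.cost] at hP'
      simp only [Cmd.vc, AExpr.eval, AExpr.cost, Op.eval]
      exact ⟨by decide, hP' _ _ (k - 1) (by omega) ⟨q + 1, by omega, by simp [w2], by simpa using w3,
        by simpa using w4, by simpa using w5, by simpa using w6, w7, w8, by omega⟩⟩
    · exact ⟨0, by omega, by simp, by simpa using hm, by simpa using h2, by simp, by simp, h4, rfl,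
        by omega⟩
    · rintro ω _ ⟨k, t', ⟨q, w1, w2, w3, w4, w5, w6, w7, w8, w9⟩, he, rfl⟩
      have hq : σ.nbr (D.E j) q = D.F j + 1 := by
        by_contra hq
        simp [AExpr.eval, Op.eval, w2, w5, w6, w7, hq] at he
      simp only [w2, w3, w4, w8]
      refine ⟨by omega, hP _ _ (idx - 1) (by omega) ⟨j + 1, by omega, by simp, ⟨by simpa using w3,
        fun i hi => ?_, fun i hi => ?_⟩, w7, ?_, fun i hi => ?_⟩⟩
      · exact (Function.update_of_ne (by omega) _ _).trans (h3.fst i hi)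
      · exact (Function.update_of_ne (by omega) _ _).trans (h3.snd i hi)
      · simp only [AExpr.cost]
        have : 50 * q ≤ 50 * D.n := by omega
        nlinarith
      · rcases Nat.lt_succ_iff_lt_or_eq.1 hi with hi | rfl
        · obtain ⟨c', e1, e2⟩ := h6 i hi
          exact ⟨c', e1, (Function.update_of_ne (by omega) _ _).trans e2⟩
        · exact ⟨q, hq, by simp⟩
  · exact ⟨0, by omega, by simp, ⟨by simpa using hin.edges, hin.fst, hin.snd⟩, rfl, by omega,
      by omega⟩
  · rintro τ _ ⟨idx, t, ⟨j, h1, h2, h3, h4, h5, h6⟩, he, rfl⟩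
    have hm := h3.edges
    have hj : j = D.m := by
      by_contra hc
      simp [AExpr.eval, Op.eval, h2, hm, show j < D.m by omega] at he
    subst hj
    exact hQ τ _ h4 hm h6 (by simp only [AExpr.cost]; omega)

/-- The whole program finds a colouring of the graph whose edges it gets. -/
theorem edgeColour_runs {D : EdgeData} (hd : ∀ v, D.count D.m v ≤ D.n) {σ : Store}
    (hin : HasInput D σ) (hdeg : ∀ v, σ.deg v = 0) (hmiss : ∀ v, σ.miss v = 0)
    (hmark : ∀ v, σ.mark v = 0) (hnbr : ∀ v c, σ.nbr v c = 0) :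
    edgeColour.Runs σ fun τ t => τ.r 1 = D.m ∧ PartialColouring (D.host hd D.m) τ.nbr ∧
      (∀ i < D.m, ∃ c, τ.nbr (D.E i) c = D.F i + 1 ∧ τ.low (D.m + D.m + i) = c + 1) ∧
      t ≤ 4001 * (D.n + 1) * (∑ v ∈ Finset.range D.n, D.count D.m v) +
        150 * (D.n + 1) * D.m + 300 * D.m + 400 := by
  refine Cmd.runs_of_vc _ _ _ ?_
  simp only [edgeColour, Cmd.vc]
  refine countDegrees_vc D hin hdeg fun τ₁ t₁ a1 a2 a4 a5 a6 a7 a8 => ?_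
  have hin₁ : HasInput D τ₁ := ⟨a2.trans hin.edges, by rw [a1]; exact hin.fst,
    by rw [a1]; exact hin.snd⟩
  refine colourEdges_vc hd hin₁ a4 (by rwa [a5]) (by rwa [a6]) (by rwa [a7])
    fun τ₂ t₂ b1 b2 b3 b4 b5 => ?_
  have hin₂ : HasInput D τ₂ := ⟨b2.trans hin₁.edges, by rw [b1]; exact hin₁.fst,
    by rw [b1]; exact hin₁.snd⟩
  refine writeColours_vc hd hin₂ b3 b4 fun τ₃ t₃ c1 c2 c3 c4 => ?_
  rw [← c1] at b3 c3
  refine ⟨c2, b3, c3, ?_⟩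
  have := Nat.mul_le_mul_left (4001 * (D.n + 1)) b3.potential_le
  rw [c1] at this
  change _ ≤ 4001 * (D.n + 1) * (∑ v ∈ Finset.range D.n, D.count D.m v) at this
  omega

/-! ### Simple graphs and edge lists -/

variable {n : ℕ} {G : SimpleGraph (Fin n)} {es : List (Fin n × Fin n)}

theorem IsEdgeList.adj (h : IsEdgeList G es) {i : ℕ} (hi : i < es.length) :
    G.Adj es[i].1 es[i].2 :=
  (h.2 s(es[i].1, es[i].2)).1 (List.mem_map.2 ⟨es[i], List.getElem_mem hi, rfl⟩)

theorem IsEdgeList.exists_index (h : IsEdgeList G es) {e : Sym2 (Fin n)} (he : e ∈ G.edgeSet) :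
    ∃ (i : ℕ) (hi : i < es.length), e = s(es[i].1, es[i].2) := by
  obtain ⟨p, hp, rfl⟩ := List.mem_map.1 ((h.2 e).2 he)
  obtain ⟨i, hi, rfl⟩ := List.getElem_of_mem hp
  exact ⟨i, hi, rfl⟩

theorem IsEdgeList.index_inj (h : IsEdgeList G es) {i j : ℕ} (hi : i < es.length)
    (hj : j < es.length) (he : s(es[i].1, es[i].2) = s(es[j].1, es[j].2)) : i = j := by
  refine (h.1.getElem_inj_iff (i := i) (j := j) (hi := by simpa using hi)
    (hj := by simpa using hj)).1 ?_
  simpa using he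

/-- The edges of an edge list, as numbers. -/
def edgeData (h : IsEdgeList G es) : EdgeData where
  n := n
  m := es.length
  E i := if hi : i < es.length then (es[i].1 : ℕ) else 0
  F i := if hi : i < es.length then (es[i].2 : ℕ) else 0
  E_lt i hi := by simp [hi]
  F_lt i hi := by simp [hi]
  ne i hi := by
    simpa [hi, Fin.val_inj] using (IsEdgeList.adj h hi).ne
  inj i hi j hj he := by
    refine IsEdgeList.index_inj h hi hj (Sym2.map.injective Fin.val_injective ?_)
    simpa [hi, hj] using he

theorem edgeData_E (h : IsEdgeList G es) {i : ℕ} (hi : i < es.length) :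
    (edgeData h).E i = es[i].1 := dif_pos hi

theorem edgeData_F (h : IsEdgeList G es) {i : ℕ} (hi : i < es.length) :
    (edgeData h).F i = es[i].2 := dif_pos hi

theorem edgeFinset_eq_image [DecidableRel G.Adj] (h : IsEdgeList G es) :
    G.edgeFinset = Finset.univ.image fun i : Fin es.length => s(es[i].1, es[i].2) := by
  ext e
  simp only [SimpleGraph.mem_edgeFinset, Finset.mem_image, Finset.mem_univ, true_and]
  constructor
  · intro he
    obtain ⟨i, hi, rfl⟩ := IsEdgeList.exists_index h he
    exact ⟨⟨i, hi⟩, rfl⟩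
  · rintro ⟨i, rfl⟩
    exact IsEdgeList.adj h i.2

theorem index_injective (h : IsEdgeList G es) :
    Function.Injective fun i : Fin es.length => s(es[i].1, es[i].2) :=
  fun i j e => Fin.ext (IsEdgeList.index_inj h i.2 j.2 e)

theorem card_edgeFinset_eq_length [DecidableRel G.Adj] (h : IsEdgeList G es) :
    G.edgeFinset.card = es.length := by
  rw [edgeFinset_eq_image h, Finset.card_image_of_injective _ (index_injective h),
    Finset.card_univ, Fintype.card_fin]

/-- The ends of an edge differ, so the two indicators in `count` add up to the indicator of
incidence. -/
theorem edgeData_count [DecidableRel G.Adj] (h : IsEdgeList G es) (v : Fin n) :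
    (edgeData h).count (edgeData h).m v = G.degree v := by
  rw [← G.card_incidenceFinset_eq_degree, G.incidenceFinset_eq_filter, Finset.card_filter,
    edgeFinset_eq_image h, Finset.sum_image (index_injective h).injOn]
  change ∑ i ∈ Finset.range es.length, _ = _
  rw [Finset.sum_range]
  refine Finset.sum_congr rfl fun i _ => ?_
  rw [edgeData_E h i.2, edgeData_F h i.2]
  have hne : es[i].1 ≠ es[i].2 := (IsEdgeList.adj h i.2).ne
  simp only [Fin.val_inj, Sym2.mem_iff]
  by_cases e1 : es[i].1 = v
  · have e2 : es[i].2 ≠ v := fun e => hne (e1.trans e.symm)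
    simp_all
  · by_cases e2 : es[i].2 = v
    · simp_all
    · simp_all [eq_comm]

theorem edgeData_count_le (h : IsEdgeList G es) (v : ℕ) :
    (edgeData h).count (edgeData h).m v ≤ (edgeData h).n := by
  classical
  by_cases hv : v < n
  · exact (edgeData_count h ⟨v, hv⟩).trans_le
      ((G.degree_lt_card_verts _).le.trans_eq (Fintype.card_fin n))
  · refine (Finset.sum_eq_zero fun i hi => ?_).trans_le (Nat.zero_le _)
    have hi := Finset.mem_range.1 hi
    have h1 := (edgeData h).E_lt i hi
    have h2 := (edgeData h).F_lt i hi
    change _ < n at h1 h2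
    rw [if_neg (by omega), if_neg (by omega), add_zero]

theorem sum_edgeData_count (h : IsEdgeList G es) :
    ∑ v ∈ Finset.range n, (edgeData h).count (edgeData h).m v = 2 * es.length := by
  classical
  rw [← card_edgeFinset_eq_length h, ← G.sum_degrees_eq_twice_card_edges, Finset.sum_range]
  exact Finset.sum_congr rfl fun v _ => edgeData_count h v

theorem length_le [DecidableRel G.Adj] (h : IsEdgeList G es) :
    2 * es.length ≤ n * G.maxDegree := by
  rw [← card_edgeFinset_eq_length h, ← G.sum_degrees_eq_twice_card_edges]
  refine (Finset.sum_le_card_nsmul _ _ _ fun v _ => G.degree_le_maxDegree v).trans_eq ?_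
  simp

/-- The store at the start of a run. -/
def inputStore (n : ℕ) (es : List (Fin n × Fin n)) : Store where
  r := (edgeListInput n es).reg
  low := (edgeListInput n es).mem
  deg _ := 0
  miss _ := 0
  mark _ := 0
  par _ := 0
  nbr _ _ := 0

theorem length_flatMap_pair (es : List (Fin n × Fin n)) :
    (es.flatMap fun p => [(p.1 : ℕ), (p.2 : ℕ)]).length = 2 * es.length := by
  induction es with
  | nil => rfl
  | cons p es ih => rw [List.flatMap_cons, List.length_append, ih, List.length_cons]; simp; omega

theorem getD_flatMap_pair (es : List (Fin n × Fin n)) {i : ℕ} (hi : i < es.length) :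
    (es.flatMap fun p => [(p.1 : ℕ), (p.2 : ℕ)]).getD (i + i) 0 = es[i].1 ∧
      (es.flatMap fun p => [(p.1 : ℕ), (p.2 : ℕ)]).getD (i + i + 1) 0 = es[i].2 := by
  induction es generalizing i with
  | nil => simp at hi
  | cons p es ih =>
    cases i with
    | zero => simp
    | succ i =>
      have := ih (i := i) (by simpa using hi)
      rw [show i + 1 + (i + 1) = i + i + 1 + 1 by omega]
      simpa using this

/-- The input fills only `2 * m` of the first `3 * m` cells and everything behind it is `0`, so the
arrays and the table start empty without initialisation. -/
theorem inputStore_state (n : ℕ) (es : List (Fin n × Fin n)) :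
    (inputStore n es).state = edgeListInput n es := by
  have hmem : ∀ a, (inputStore n es).state.mem a = (edgeListInput n es).mem a := by
    intro a
    change (if a < 3 * es.length then (edgeListInput n es).mem a else
      (inputStore n es).high ((a - 3 * es.length) / 5) ((a - 3 * es.length) % 5)) = _
    split_ifs with ha
    · rfl
    · have h0 : ∀ q i, (inputStore n es).high q i = 0 := by
        intro q i
        unfold Store.high
        split <;> simp [inputStore]
      rw [h0]
      refine (List.getD_eq_default _ _ ?_).symm
      rw [length_flatMap_pair]
      omega
  rw [show edgeListInput n es = ⟨(edgeListInput n es).reg, (edgeListInput n es).mem⟩ from rfl,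
    ← funext hmem]
  rfl

theorem inputStore_hasInput (h : IsEdgeList G es) :
    HasInput (edgeData h) (inputStore n es) where
  edges := rfl
  fst _ hi := ((getD_flatMap_pair es hi).1).trans (edgeData_E h hi).symm
  snd _ hi := ((getD_flatMap_pair es hi).2).trans (edgeData_F h hi).symm

theorem edgeListInput_boundedBy {es : List (Fin n × Fin n)} {B : ℕ} (hn : n ≤ B)
    (hm : es.length ≤ B) : (edgeListInput n es).BoundedBy B := by
  constructor
  · intro i
    simp only [edgeListInput]
    split_ifs <;> omega
  · intro a
    simp only [edgeListInput]
    by_cases ha : a < (es.flatMap fun p => [(p.1 : ℕ), (p.2 : ℕ)]).length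
    · rw [List.getD_eq_getElem _ _ ha]
      have := List.getElem_mem ha
      obtain ⟨p, -, hp⟩ := List.mem_flatMap.1 this
      simp only [List.mem_cons, List.not_mem_nil, or_false] at hp
      have := p.1.2
      have := p.2.2
      omega
    · rw [List.getD_eq_default _ _ (by omega)]
      omega

/-- The table of a partial colouring in which no edge lacks a colour describes a strictly local
edge colouring. -/
theorem exists_colouring [DecidableRel G.Adj] (h : IsEdgeList G es) {f : ℕ → ℕ → ℕ}
    (hf : PartialColouring ((edgeData h).host (edgeData_count_le h) es.length) f)
    (hcol : ∀ i < es.length, ∃ c, f ((edgeData h).E i) c = (edgeData h).F i + 1) :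
    ∃ c : G.lineGraph.Coloring ℕ, IsStrictlyLocal G c ∧
      ∀ (e : G.edgeSet) (u v : Fin n) (q : ℕ), (e : Sym2 (Fin n)) = s(u, v) →
        f u q = v + 1 → c e = q + 1 := by
  have hex : ∀ e : G.edgeSet, ∃ q, ∀ u v : Fin n, (e : Sym2 (Fin n)) = s(u, v) →
      f u q = v + 1 := by
    rintro ⟨e, he⟩
    obtain ⟨i, hi, rfl⟩ := IsEdgeList.exists_index h he
    obtain ⟨q, hq⟩ := hcol i hi
    rw [edgeData_E h hi, edgeData_F h hi] at hq
    refine ⟨q, fun u v huv => ?_⟩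
    rcases Sym2.eq_iff.1 huv with ⟨rfl, rfl⟩ | ⟨rfl, rfl⟩
    · exact hq
    · exact hf.symm hq
  choose q hq using hex
  -- Table colours start at `0`; adding `1` moves them into the required range.
  refine ⟨SimpleGraph.Coloring.mk (fun e => q e + 1) ?_, ?_, ?_⟩
  · intro e e' hadj he
    obtain ⟨hne, w, hw, hw'⟩ := SimpleGraph.lineGraph_adj_iff_exists.1 hadj
    obtain ⟨x, hx⟩ := Sym2.mem_iff_exists.1 hw
    obtain ⟨y, hy⟩ := Sym2.mem_iff_exists.1 hw'
    have h1 := hq e w x hx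
    have h2 := hq e' w y hy
    rw [Nat.succ_injective he, h2] at h1
    refine hne (Subtype.ext ?_)
    rw [hx, hy, Fin.ext (Nat.succ_injective h1)]
  · intro u v huv
    have h1 := hf.le (hq ⟨s(u, v), huv⟩ u v rfl)
    change _ ≤ max ((edgeData h).count (edgeData h).m u)
      ((edgeData h).count (edgeData h).m v) at h1
    rw [edgeData_count, edgeData_count] at h1
    rw [Finset.mem_Icc]
    change 1 ≤ q _ + 1 ∧ q _ + 1 ≤ _
    omega
  · intro e u v p huv hp
    exact congrArg (· + 1) (hf.inj (hq e u v huv) hp)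

/-! ### Running time and word size -/

/-- The running time in terms of the number of vertices and the maximum degree. -/
theorem time_le {n m Δ t : ℕ} (hm : 2 * m ≤ n * Δ)
    (ht : t ≤ 4001 * (n + 1) * (2 * m) + 150 * (n + 1) * m + 300 * m + 400) :
    t ≤ 9000 * (n ^ 2 * Δ + 1) := by
  rcases Nat.eq_zero_or_pos m with rfl | hpos
  · omega
  have hn : 1 ≤ n := by
    by_contra hn
    obtain rfl : n = 0 := by omega
    omega
  have h1 : (n + 1) * (2 * m) ≤ 2 * (n ^ 2 * Δ) := by
    calc (n + 1) * (2 * m) ≤ (2 * n) * (n * Δ) := Nat.mul_le_mul (by omega) hm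
      _ = 2 * (n ^ 2 * Δ) := by ring
  have h2 : 2 * (2 * m) ≤ (n + 1) * (2 * m) := Nat.mul_le_mul_right _ (by omega)
  have h3 : t ≤ 4001 * ((n + 1) * (2 * m)) + 75 * ((n + 1) * (2 * m)) + 300 * m + 400 := by
    refine ht.trans_eq ?_
    ring
  omega

/-- Numbers of polynomial size are words. -/
theorem pow_lt_word {n B t : ℕ} (hB : B ≤ (n + 2) ^ 3) (ht : t ≤ 9000 * (n + 2) ^ 3) :
    (B + t + 8) ^ 40 < (n + 2) ^ 681 := by
  -- The constants are absorbed into powers of `n + 2 ≥ 2`: one gets exponent `3 + 14`, multiplied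
  -- by the weight `40`, plus `1` for strictness.
  have h8 : 2 ^ 3 ≤ (n + 2) ^ 3 := Nat.pow_le_pow_left (by omega) 3
  have h14 : 2 ^ 14 ≤ (n + 2) ^ 14 := Nat.pow_le_pow_left (by omega) 14
  have h : B + t + 8 ≤ (n + 2) ^ 17 := by
    calc B + t + 8 ≤ 2 ^ 14 * (n + 2) ^ 3 := by omega
      _ ≤ (n + 2) ^ 14 * (n + 2) ^ 3 := Nat.mul_le_mul_right _ h14
      _ = (n + 2) ^ 17 := by rw [← pow_add]
  calc (B + t + 8) ^ 40 ≤ ((n + 2) ^ 17) ^ 40 := Nat.pow_le_pow_left h 40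
    _ = (n + 2) ^ (17 * 40) := (pow_mul _ 17 40).symm
    _ < (n + 2) ^ 681 := pow_lt_pow_right₀ (by omega) (Nat.lt_succ_self 680)

end EdgeColouring

open EdgeColouring in
theorem corollary1p3 :
    ∃ (P : WordRAM.Prog) (C k : ℕ),
      ∀ (n : ℕ) (G : SimpleGraph (Fin n)) [DecidableRel G.Adj] (es : List (Fin n × Fin n)),
        IsEdgeList G es →
          ∃ (s : WordRAM.State) (t : ℕ) (c : G.lineGraph.Coloring ℕ),
            WordRAM.Exec ((n + 2) ^ k) P (edgeListInput n es) s t ∧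
            t ≤ C * (n ^ 2 * G.maxDegree + 1) ∧
            IsStrictlyLocal G c ∧
            DisplaysColouring G es c s := by
  refine ⟨edgeColour.compile, 9000, 681, fun n G _ es h => ?_⟩
  obtain ⟨τ, t, hrun, h1, hf, hcol, ht⟩ := edgeColour_runs (edgeData_count_le h)
    (inputStore_hasInput h) (fun _ => rfl) (fun _ => rfl) (fun _ => rfl) fun _ _ => rfl
  rw [inputStore_state] at hrun
  change t ≤ 4001 * (n + 1) * (∑ v ∈ Finset.range n, (edgeData h).count (edgeData h).m v) +
    150 * (n + 1) * es.length + 300 * es.length + 400 at ht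
  rw [sum_edgeData_count h] at ht
  have hm := length_le h
  have htime := time_le hm ht
  have hΔ : G.maxDegree ≤ n := G.maxDegree_le_of_forall_degree_le n fun v =>
    (G.degree_lt_card_verts v).le.trans_eq (Fintype.card_fin n)
  have hm2 : 2 * es.length ≤ n * n := hm.trans (Nat.mul_le_mul_left n hΔ)
  have hB : n * n + n ≤ (n + 2) ^ 3 := by ring_nf; nlinarith
  have ht3 : t ≤ 9000 * (n + 2) ^ 3 := by
    refine htime.trans (Nat.mul_le_mul_left _ ?_)
    have := Nat.mul_le_mul_left (n ^ 2) hΔ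
    ring_nf at this ⊢
    omega
  obtain ⟨c, hc, hdisp⟩ := exists_colouring h hf fun i hi => (hcol i hi).imp fun _ e => e.1
  refine ⟨τ.state, t, c, (hrun.exec edgeColour_tame
    (edgeListInput_boundedBy (B := n * n + n) (by omega) (by omega)) (pow_lt_word hB ht3)).1,
    htime, hc, ?_⟩
  intro j hj e he
  obtain ⟨q, hq, hlow⟩ := hcol j hj
  rw [edgeData_E h hj, edgeData_F h hj] at hq
  rw [hdisp e _ _ q he hq, ← hlow]
  change (if 2 * es.length + j < 3 * τ.r 1 then τ.low (2 * es.length + j) else _) = _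
  have h1' : τ.r 1 = es.length := h1
  -- The output cell lies below `3 * m`, in the part that the store keeps as `low`.
  rw [if_pos (by omega), two_mul]
  rfl
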